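/- Let $n\ge 1$, let $D$ be the standard flat connection on $\mathbb{R}^{n+1}$ and let $\Psi = c\,dx^1\wedge\dots\wedge dx^{n+1}$, $c\neq 0$ constant, be a parallel volume form. Let $F$ be a $C^\infty$ function on an open set $V\subset\mathbb{R}^{n+1}$, and write $F_i=\partial_iF$, $F_{ij}=\partial_i\partial_jF$. Define $H(F)=c^{-2}\det(F_{ij})$, $U^{ij}=c^{-2}\operatorname{adj}(F_{\cdot\cdot})^{ij}$ (so that $U^{ip}F_{pj}=H(F)\delta_j{}^i$), $N^i=U^{ip}F_p$ and $U(F)=N^iF_i=U^{ij}F_iF_j$. Let $\Omega$ be a connected component of $\{x\in V: U(F)(x)\neq0\}$. On $\Omega$ put $\mu=(n+2)^{-1}d\log|U(F)|=(n+2)^{-1}U(F)^{-1}dU(F)$ and $\Pi_{ij}=F_{ij}-U(F)^{-1}H(F)F_iF_j$. Let $q\in C^\infty(\Omega)$ be any nowhere vanishing function, let $m^{ij}$ be the inverse of $m_{ij}=\Pi_{ij}+q\,U(F)^{-1}F_iF_j$, and put $$\Pi^{ij}=m^{ij}-q^{-1}U(F)^{-1}N^iN^j,\qquad k^{ij}=|U(F)|^{1/(n+2)}\Pi^{ij},$$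 $$\nu^i=-|U(F)|^{1/(n+2)}U(F)^{-1}N^i-k^{ip}\mu_p .$$ Let $r\in\mathbb{R}$ be such that $\Sigma=\{x\in\Omega: F(x)=r\}$ is nonempty. Then $\Sigma$ is a smooth hypersurface, and the restriction of $\nu$ to $\Sigma$ is the equiaffine normal of $\Sigma$ co-oriented by $-\operatorname{sign}(U(F))N$. That is, a vector field $\xi$ along $\Sigma$ equals $\nu$ on $\Sigma$ if and only if (a) $\xi$ is smooth and transverse to $\Sigma$, and at each point of $\Sigma$ it lies on the same side of the tangent hyperplane as $-\operatorname{sign}(U(F))N$; and (b) if $\nabla$ and $h$ are the connection and the second fundamental form induced on $\Sigma$ by $\xi$ through $D_XY=\nabla_XY+h(X,Y)\,\xi$ for $X,Y$ tangent to $\Sigma$, then the volume densities $|\iota(\xi)\Psi|$ and $|\mathrm{vol}_h|$ (where $|\mathrm{vol}_h|=\sqrt{|\det(h_{ab})|}\,|du^1\wedge\dots\wedge du^n|$ in local coordinates $u^1,\dots,u^n$) coincide and are $\nabla$-parallel. No assumption is made on $H(F)$, which may vanish at some or all points of $\Omega$. -/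

import Mathlib

open scoped ContDiff Topology

noncomputable section

namespace Equiaffine

/-- The partial derivative `∂f/∂xⁱ` of a function on `ℝᵏ`. Only the underlying vector space of
`Fin k → ℝ` matters here; its norm plays no role. -/
def pd {k : ℕ} {V : Type*} [NormedAddCommGroup V] [NormedSpace ℝ V]
    (f : (Fin k → ℝ) → V) (i : Fin k) (x : Fin k → ℝ) : V :=
  fderiv ℝ f x (Pi.single i 1)

/-! ### Tensors attached to a function

`Ψ` is a nonzero alternating `(n+1)`-form on `ℝⁿ⁺¹`, that is, a volume form that is parallel for the
standard flat connection (a form with constant coefficients). Tensors on `ℝⁿ⁺¹` are written through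
their components in the standard coordinates. -/

section Tensors

variable {n : ℕ} (Ψ : (Fin (n + 1) → ℝ) [⋀^Fin (n + 1)]→ₗ[ℝ] ℝ) (F : (Fin (n + 1) → ℝ) → ℝ)

/-- The component `c` of the volume form `Ψ = c dx¹ ∧ ⋯ ∧ dxⁿ⁺¹`. -/
def volCoeff : ℝ := Ψ (fun i => Pi.single i 1)

/-- The components `F_i` of `dF`. -/
def dF (x : Fin (n + 1) → ℝ) : Fin (n + 1) → ℝ := fun i => pd F i x

/-- The components `F_{ij}` of the Hessian of `F` with respect to the flat connection. -/
def hess (x : Fin (n + 1) → ℝ) : Matrix (Fin (n + 1)) (Fin (n + 1)) ℝ :=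
  Matrix.of fun i j => pd (fun y => pd F j y) i x

/-- The Hessian determinant `H(F)`, defined by `det Hess F = H(F) Ψ²`. -/
def hessDet (x : Fin (n + 1) → ℝ) : ℝ := (hess F x).det / volCoeff Ψ ^ 2

/-- The adjugate tensor `U^{ij}`, for which `U^{ip} F_{pj} = H(F) δ_j^i`. -/
def adjTensor (x : Fin (n + 1) → ℝ) : Matrix (Fin (n + 1)) (Fin (n + 1)) ℝ :=
  (volCoeff Ψ ^ 2)⁻¹ • (hess F x).adjugate

/-- The vector field `N^i = U^{ip} F_p`. -/
def fieldN (x : Fin (n + 1) → ℝ) : Fin (n + 1) → ℝ :=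
  Matrix.mulVec (adjTensor Ψ F x) (dF F x)

/-- The function `U(F) = N^i F_i = U^{ij} F_i F_j`. -/
def opU (x : Fin (n + 1) → ℝ) : ℝ := dotProduct (fieldN Ψ F x) (dF F x)

/-- The one-form `μ = (n+2)⁻¹ d log U(F)`. Since `Real.log t = log |t|`, this is
`(n+2)⁻¹ U(F)⁻¹ dU(F)` where `U(F)` is not zero, whatever its sign. -/
def mu (x : Fin (n + 1) → ℝ) : Fin (n + 1) → ℝ :=
  fun i => ((n : ℝ) + 2)⁻¹ * pd (fun y => Real.log (opU Ψ F y)) i x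

/-- The tensor `Π_{ij} = F_{ij} - U(F)⁻¹ H(F) F_i F_j`. -/
def tensorPi (x : Fin (n + 1) → ℝ) : Matrix (Fin (n + 1)) (Fin (n + 1)) ℝ :=
  hess F x - ((opU Ψ F x)⁻¹ * hessDet Ψ F x) • Matrix.vecMulVec (dF F x) (dF F x)

/-- The tensor `m_{ij} = Π_{ij} + q U(F)⁻¹ F_i F_j`, for an auxiliary nonvanishing function `q`. -/
def tensorM (q : (Fin (n + 1) → ℝ) → ℝ) (x : Fin (n + 1) → ℝ) :
    Matrix (Fin (n + 1)) (Fin (n + 1)) ℝ :=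
  tensorPi Ψ F x + (q x * (opU Ψ F x)⁻¹) • Matrix.vecMulVec (dF F x) (dF F x)

/-- The tensor `Π^{ij} = m^{ij} - q⁻¹ U(F)⁻¹ N^i N^j`, where `m^{ij}` is the inverse of `m_{ij}`. -/
def tensorPiUp (q : (Fin (n + 1) → ℝ) → ℝ) (x : Fin (n + 1) → ℝ) :
    Matrix (Fin (n + 1)) (Fin (n + 1)) ℝ :=
  (tensorM Ψ F q x)⁻¹ -
    ((q x)⁻¹ * (opU Ψ F x)⁻¹) • Matrix.vecMulVec (fieldN Ψ F x) (fieldN Ψ F x)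

/-- The tensor `k^{ij} = |U(F)|^{1/(n+2)} Π^{ij}`. -/
def tensorKUp (q : (Fin (n + 1) → ℝ) → ℝ) (x : Fin (n + 1) → ℝ) :
    Matrix (Fin (n + 1)) (Fin (n + 1)) ℝ :=
  (|opU Ψ F x| ^ (1 / ((n : ℝ) + 2))) • tensorPiUp Ψ F q x

/-- The vector field `ν^i = -|U(F)|^{1/(n+2)} U(F)⁻¹ N^i - k^{ip} μ_p`. -/
def fieldNu (q : (Fin (n + 1) → ℝ) → ℝ) (x : Fin (n + 1) → ℝ) : Fin (n + 1) → ℝ :=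
  -((|opU Ψ F x| ^ (1 / ((n : ℝ) + 2)) * (opU Ψ F x)⁻¹) • fieldN Ψ F x) -
    Matrix.mulVec (tensorKUp Ψ F q x) (mu Ψ F x)

end Tensors

/-! ### Affine geometry of a hypersurface -/

section Hypersurface

variable {n : ℕ}

/-- `φ`, on the open set `W ⊆ ℝⁿ`, is a smooth immersion into `ℝⁿ⁺¹` with image in `S`. -/
structure IsPatch (S : Set (Fin (n + 1) → ℝ)) (W : Set (Fin n → ℝ))
    (φ : (Fin n → ℝ) → (Fin (n + 1) → ℝ)) : Prop where
  isOpen : IsOpen W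
  smooth : ContDiffOn ℝ ∞ φ W
  immersion : ∀ w ∈ W, LinearIndependent ℝ (fun a => pd φ a w)
  mapsTo : Set.MapsTo φ W S

/-- `S` is a smooth hypersurface in `ℝⁿ⁺¹`: near each of its points it is the homeomorphic image of
an immersed patch. -/
def IsHypersurface (S : Set (Fin (n + 1) → ℝ)) : Prop :=
  ∀ p ∈ S, ∃ (O : Set (Fin (n + 1) → ℝ)) (W : Set (Fin n → ℝ))
    (φ : (Fin n → ℝ) → (Fin (n + 1) → ℝ)) (ψ : (Fin (n + 1) → ℝ) → (Fin n → ℝ)),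
    IsOpen O ∧ p ∈ O ∧ IsPatch S W φ ∧ φ '' W = S ∩ O ∧
      ContinuousOn ψ (S ∩ O) ∧ ∀ w ∈ W, ψ (φ w) = w

/-- The tangent space of the hypersurface at `φ w`, for a patch `φ`. -/
def tangentSpan (φ : (Fin n → ℝ) → (Fin (n + 1) → ℝ)) (w : Fin n → ℝ) :
    Submodule ℝ (Fin (n + 1) → ℝ) :=
  Submodule.span ℝ (Set.range fun a => pd φ a w)

/-- `ξ` restricts to a smooth vector field along `S` that is nowhere tangent to `S`. -/
def IsTransversal (S : Set (Fin (n + 1) → ℝ))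
    (ξ : (Fin (n + 1) → ℝ) → (Fin (n + 1) → ℝ)) : Prop :=
  ∀ (W : Set (Fin n → ℝ)) (φ : (Fin n → ℝ) → (Fin (n + 1) → ℝ)), IsPatch S W φ →
    ContDiffOn ℝ ∞ (fun w => ξ (φ w)) W ∧ ∀ w ∈ W, ξ (φ w) ∉ tangentSpan φ w

/-- Along `S` the vectors `ξ` and `ζ` lie on the same side of the tangent hyperplane: modulo
tangent vectors, `ξ` is a positive multiple of `ζ`. For transversals this says that they determine
the same co-orientation. -/
def SameCoorientation (S : Set (Fin (n + 1) → ℝ))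
    (ξ ζ : (Fin (n + 1) → ℝ) → (Fin (n + 1) → ℝ)) : Prop :=
  ∀ (W : Set (Fin n → ℝ)) (φ : (Fin n → ℝ) → (Fin (n + 1) → ℝ)), IsPatch S W φ →
    ∀ w ∈ W, ∃ c : ℝ, 0 < c ∧ ξ (φ w) - c • ζ (φ w) ∈ tangentSpan φ w

/-- In the coordinates given by the patch `φ`, the functions `Γ w a b c = Γ_{ab}^c(w)` are the
Christoffel symbols of the connection `∇` and `h w = (h_{ab}(w))` is the matrix of the second
fundamental form which are induced by the flat connection `D` and the transversal `ξ`: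
`D_X Y = ∇_X Y + h(X, Y) ξ` for coordinate fields `X = ∂_a`, `Y = ∂_b`. For transverse `ξ` this
determines `Γ` and `h` on `W`. -/
def GaussFormula (W : Set (Fin n → ℝ)) (φ : (Fin n → ℝ) → (Fin (n + 1) → ℝ))
    (ξ : (Fin (n + 1) → ℝ) → (Fin (n + 1) → ℝ))
    (Γ : (Fin n → ℝ) → Fin n → Fin n → Fin n → ℝ)
    (h : (Fin n → ℝ) → Matrix (Fin n) (Fin n) ℝ) : Prop :=
  ∀ w ∈ W, ∀ a b : Fin n,
    pd (fun v => pd φ b v) a w = ∑ c, Γ w a b c • pd φ c w + h w a b • ξ (φ w)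

/-- The induced volume density `|ι(ξ)Ψ|`, evaluated on the coordinate frame of the patch `φ`. -/
def inducedDensity (Ψ : (Fin (n + 1) → ℝ) [⋀^Fin (n + 1)]→ₗ[ℝ] ℝ)
    (φ : (Fin n → ℝ) → (Fin (n + 1) → ℝ)) (ξ : (Fin (n + 1) → ℝ) → (Fin (n + 1) → ℝ))
    (w : Fin n → ℝ) : ℝ :=
  |Ψ (Fin.cons (ξ (φ w)) (fun a => pd φ a w))|

/-- The volume density `|vol_h|` of the symmetric form `h`, evaluated on the coordinate frame. -/
def metricDensity (h : (Fin n → ℝ) → Matrix (Fin n) (Fin n) ℝ) (w : Fin n → ℝ) : ℝ :=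
  √|(h w).det|

/-- The density `ρ |du¹ ∧ ⋯ ∧ duⁿ|` on `W` is parallel for the connection with Christoffel symbols
`Γ`: `(∇_a ρ)(∂_1, …, ∂_n) = ∂_a ρ - Γ_{ab}^b ρ` vanishes. -/
def IsParallelDensity (W : Set (Fin n → ℝ)) (Γ : (Fin n → ℝ) → Fin n → Fin n → Fin n → ℝ)
    (ρ : (Fin n → ℝ) → ℝ) : Prop :=
  DifferentiableOn ℝ ρ W ∧ ∀ w ∈ W, ∀ a : Fin n, pd ρ a w - (∑ b, Γ w a b b) * ρ w = 0

/-- `ξ` is an equiaffine normal of the hypersurface `S` with respect to the volume form `Ψ`: it is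
a transversal such that the volume densities `|ι(ξ)Ψ|` and `|vol_h|` coincide and are parallel with
respect to the induced connection, where `h` and the connection are induced via `ξ`.
As `ξ` is transverse and `Ψ ≠ 0`, equality of the densities forces `h` to be nondegenerate. -/
structure IsEquiaffineNormal (Ψ : (Fin (n + 1) → ℝ) [⋀^Fin (n + 1)]→ₗ[ℝ] ℝ)
    (S : Set (Fin (n + 1) → ℝ)) (ξ : (Fin (n + 1) → ℝ) → (Fin (n + 1) → ℝ)) : Prop where
  hypersurface : IsHypersurface S
  transversal : IsTransversal S ξ
  normalized : ∀ (W : Set (Fin n → ℝ)) (φ : (Fin n → ℝ) → (Fin (n + 1) → ℝ)), IsPatch S W φ →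
    ∃ (Γ : (Fin n → ℝ) → Fin n → Fin n → Fin n → ℝ) (h : (Fin n → ℝ) → Matrix (Fin n) (Fin n) ℝ),
      GaussFormula W φ ξ Γ h ∧
      (∀ w ∈ W, inducedDensity Ψ φ ξ w = metricDensity h w) ∧
      IsParallelDensity W Γ (inducedDensity Ψ φ ξ) ∧
      IsParallelDensity W Γ (metricDensity h)

end Hypersurface

end Equiaffine

end

/-! Along a level set everything is governed by the function `dF(ξ)`. Differentiating `dF(∂_b φ) =
0` gives `h = -dF(ξ)⁻¹ Hess F` on tangent vectors, and `dF(N) = U(F) ≠ 0` makes `N` a reference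
transversal.

Normalization. The Gram determinant of the frame `(N, T)` for `m` gives `Ψ(ξ, T)² U = dF(ξ)²
det(Hess F|_T)` (`sq_apply_cons`), while `vol_h²` is `|dF(ξ)|⁻ⁿ |det(Hess F|_T)|`. Given `dF(ξ) <
0`, which is the co-orientation, the densities agree exactly when `dF(ξ) = -|U|^{1/(n+2)}`
(`density_eq_iff`).

Parallelism. The logarithmic derivative of `|ι(ξ)Ψ|` exceeds the trace of `Γ` by `dF(D_a ξ) / dF(ξ)`
(`pd_inducedDensity`), so `D ξ` must be tangential. Differentiating the normalization turns this
into `Hess F(∂_a, ξ) = -|U|^{1/(n+2)} μ(∂_a)` (`dF_dotProduct_pd_comp_eq`).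

These two conditions determine `ξ`, because the Hessian is nondegenerate on tangent vectors wherever
`U ≠ 0`. The field `ν` satisfies both, because `Π^{ij}` takes tangent values and inverts the
tangential Hessian. `H(F)` is never inverted: it cancels from `det m = c² q`, so its zeros are
harmless. -/

open scoped ContDiff Topology
noncomputable section
namespace Equiaffine

/-! ### Linear algebra -/

section LinearAlgebra

open Matrix

/-- The matrix determinant lemma, without invertibility assumptions. -/
theorem det_add_smul_vecMulVec {ι : Type*} [Fintype ι] [DecidableEq ι] (A : Matrix ι ι ℝ) (s : ℝ)
    (u v : ι → ℝ) :
    (A + s • vecMulVec u v).det = A.det + s * (v ⬝ᵥ (A.adjugate *ᵥ u)) := by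
  have key : ∀ B : Matrix ι ι ℝ, B.det ≠ 0 →
      (B + s • vecMulVec u v).det = B.det + s * (v ⬝ᵥ (B.adjugate *ᵥ u)) := by
    intro B hB
    have h := det_add_replicateCol_mul_replicateRow (ι := Unit) (isUnit_iff_ne_zero.2 hB) (s • u) v
    have e1 : replicateCol Unit (s • u) * replicateRow Unit v = s • vecMulVec u v := by
      ext i j
      simp [Matrix.mul_apply, vecMulVec_apply, mul_assoc]
    rw [e1] at h
    rw [h, det_unique (1 + _), Matrix.add_apply, Matrix.mul_assoc, one_apply_eq]
    have e2 : (replicateRow Unit v * (B⁻¹ * replicateCol Unit (s • u))) default default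
        = s * (v ⬝ᵥ (B⁻¹ *ᵥ u)) := by
      rw [← replicateCol_mulVec, replicateRow_mul_replicateCol_apply, mulVec_smul, dotProduct_smul,
        smul_eq_mul]
    rw [e2, Matrix.inv_def, Ring.inverse_eq_inv', smul_mulVec, dotProduct_smul, smul_eq_mul]
    field_simp
  -- The singular case follows by continuity from `A + t • 1`, which is singular only when `t` is
  -- one of the finitely many roots of the characteristic polynomial of `-A`.
  have hdense : Dense {t : ℝ | (A + t • (1 : Matrix ι ι ℝ)).det ≠ 0} := by
    have hfin : {t : ℝ | (A + t • (1 : Matrix ι ι ℝ)).det = 0}.Finite := by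
      refine ((-A).charpoly.roots.toFinset.finite_toSet).subset fun t ht => ?_
      have hne : (-A).charpoly ≠ 0 := (charpoly_monic _).ne_zero
      simp only [Finset.mem_coe, Multiset.mem_toFinset, Polynomial.mem_roots hne,
        Polynomial.IsRoot.def, eval_charpoly]
      rw [Set.mem_ofPred_eq] at ht
      rw [← ht, sub_neg_eq_add, add_comm]
      congr 2
      ext i j
      simp [Matrix.scalar_apply, Matrix.diagonal_apply, Matrix.one_apply]
    exact hfin.countable.dense_compl ℝ
  have hext := Continuous.ext_on hdense
    (f := fun t : ℝ => ((A + t • (1 : Matrix ι ι ℝ)) + s • vecMulVec u v).det)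
    (g := fun t : ℝ => (A + t • (1 : Matrix ι ι ℝ)).det
      + s * (v ⬝ᵥ ((A + t • (1 : Matrix ι ι ℝ)).adjugate *ᵥ u)))
    (by fun_prop)
    (by
      have h1 : Continuous fun t : ℝ => A + t • (1 : Matrix ι ι ℝ) := by fun_prop
      exact h1.matrix_det.add (continuous_const.mul
        (continuous_const.dotProduct (h1.matrix_adjugate.matrix_mulVec continuous_const))))
    (fun t ht => key _ ht)
  simpa using congrFun hext 0

/-- Replacing the `i`-th argument of an alternating map by a linear combination of the arguments
multiplies the value by the `i`-th coefficient. -/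
theorem map_update_eq_mul {ι M : Type*} [Fintype ι] [DecidableEq ι] [AddCommGroup M] [Module ℝ M]
    (Ψ : M [⋀^ι]→ₗ[ℝ] ℝ) (v : ι → M) (i : ι) (t : ι → ℝ) :
    Ψ (Function.update v i (∑ j, t j • v j)) = t i * Ψ v := by
  rw [Ψ.map_update_sum]
  rw [Finset.sum_eq_single i]
  · rw [Ψ.map_update_smul, Function.update_eq_self, smul_eq_mul]
  · intro j _ hj
    rw [Ψ.map_update_smul, Ψ.map_update_self _ hj.symm, smul_zero]
  · simp

variable {n : ℕ}

theorem volCoeff_ne_zero {Ψ : (Fin (n + 1) → ℝ) [⋀^Fin (n + 1)]→ₗ[ℝ] ℝ} (hΨ : Ψ ≠ 0) :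
    volCoeff Ψ ≠ 0 := by
  have := (Ψ.map_basis_ne_zero_iff (Pi.basisFun ℝ (Fin (n + 1)))).2 hΨ
  rwa [show ⇑(Pi.basisFun ℝ (Fin (n + 1))) = fun i => Pi.single i 1 by ext i; simp] at this

theorem apply_eq_volCoeff_mul_det (Ψ : (Fin (n + 1) → ℝ) [⋀^Fin (n + 1)]→ₗ[ℝ] ℝ)
    (v : Fin (n + 1) → Fin (n + 1) → ℝ) : Ψ v = volCoeff Ψ * (Matrix.of v).det := by
  have h := congrArg (fun Φ => Φ v) (Ψ.eq_smul_basis_det (Pi.basisFun ℝ (Fin (n + 1))))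
  have e : (fun i : Fin (n + 1) => (Pi.single i 1 : Fin (n + 1) → ℝ))
      = ⇑(Pi.basisFun ℝ (Fin (n + 1))) := by
    ext i; simp
  simp only [AlternatingMap.smul_apply, Module.Basis.det_apply, smul_eq_mul] at h
  rw [h, volCoeff, e, ← det_transpose]
  congr 2

/-- The tangent vectors to a hypersurface with conormal `g`: a linearly independent family of `n`
vectors annihilated by `g ≠ 0` spans the kernel of `g`. -/
theorem span_range_eq_of_dotProduct_eq_zero {T : Fin n → Fin (n + 1) → ℝ} {g y : Fin (n + 1) → ℝ}
    (hT : LinearIndependent ℝ T) (hgT : ∀ a, g ⬝ᵥ T a = 0) (hg : g ≠ 0) :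
    y ∈ Submodule.span ℝ (Set.range T) ↔ g ⬝ᵥ y = 0 := by
  let l : (Fin (n + 1) → ℝ) →ₗ[ℝ] ℝ := dotProductBilin ℝ ℝ g
  have hl : ∀ y, l y = g ⬝ᵥ y := fun y => rfl
  have hl0 : l ≠ 0 := by
    intro h
    apply hg
    rw [← dotProduct_self_eq_zero, ← hl, h]; rfl
  have hle : Submodule.span ℝ (Set.range T) ≤ LinearMap.ker l := by
    rw [Submodule.span_le]
    rintro _ ⟨a, rfl⟩
    exact hgT a
  have hk : Module.finrank ℝ (LinearMap.ker l) = n := by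
    have h1 := l.finrank_range_add_finrank_ker
    rw [LinearMap.range_eq_top.2 (LinearMap.surjective hl0)] at h1
    simp at h1
    omega
  have heq : Submodule.span ℝ (Set.range T) = LinearMap.ker l := by
    apply Submodule.eq_of_le_of_finrank_eq hle
    rw [hk, finrank_span_eq_card hT, Fintype.card_fin]
  rw [heq, LinearMap.mem_ker, hl]

/-- Splitting of a vector into a transversal and a tangent component. -/
theorem exists_eq_sum_add_smul {T : Fin n → Fin (n + 1) → ℝ} {g ξ : Fin (n + 1) → ℝ}
    (hT : LinearIndependent ℝ T) (hgT : ∀ a, g ⬝ᵥ T a = 0) (hξ : g ⬝ᵥ ξ ≠ 0)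
    (y : Fin (n + 1) → ℝ) :
    ∃ t : Fin n → ℝ, y = ∑ c, t c • T c + (g ⬝ᵥ y / g ⬝ᵥ ξ) • ξ := by
  have hg : g ≠ 0 := by rintro rfl; simp at hξ
  have : y - (g ⬝ᵥ y / g ⬝ᵥ ξ) • ξ ∈ Submodule.span ℝ (Set.range T) := by
    rw [span_range_eq_of_dotProduct_eq_zero hT hgT hg, dotProduct_sub, dotProduct_smul, smul_eq_mul]
    field_simp
    ring
  obtain ⟨t, ht⟩ := (Submodule.mem_span_range_iff_exists_fun ℝ).1 this
  exact ⟨t, by rw [ht]; abel⟩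

theorem linearIndependent_cons_of_dotProduct_ne_zero {T : Fin n → Fin (n + 1) → ℝ}
    {g ξ : Fin (n + 1) → ℝ} (hT : LinearIndependent ℝ T) (hgT : ∀ a, g ⬝ᵥ T a = 0)
    (hξ : g ⬝ᵥ ξ ≠ 0) : LinearIndependent ℝ (Fin.cons ξ T : Fin (n + 1) → Fin (n + 1) → ℝ) := by
  have hg : g ≠ 0 := by rintro rfl; simp at hξ
  rw [linearIndependent_finCons, span_range_eq_of_dotProduct_eq_zero hT hgT hg]
  exact ⟨hT, hξ⟩

theorem apply_cons_ne_zero {Ψ : (Fin (n + 1) → ℝ) [⋀^Fin (n + 1)]→ₗ[ℝ] ℝ} (hΨ : Ψ ≠ 0)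
    {T : Fin n → Fin (n + 1) → ℝ} {g ξ : Fin (n + 1) → ℝ} (hT : LinearIndependent ℝ T)
    (hgT : ∀ a, g ⬝ᵥ T a = 0) (hξ : g ⬝ᵥ ξ ≠ 0) :
    Ψ (Fin.cons ξ T : Fin (n + 1) → Fin (n + 1) → ℝ) ≠ 0 := by
  rw [apply_eq_volCoeff_mul_det]
  refine mul_ne_zero (volCoeff_ne_zero hΨ) ?_
  have := linearIndependent_cons_of_dotProduct_ne_zero hT hgT hξ
  exact ((Matrix.isUnit_iff_isUnit_det _).1 (Matrix.linearIndependent_rows_iff_isUnit.1 this)).ne_zero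

/-- Changing the transversal changes the volume of the frame by the ratio of the conormal values. -/
theorem apply_cons_mul_dotProduct (Ψ : (Fin (n + 1) → ℝ) [⋀^Fin (n + 1)]→ₗ[ℝ] ℝ)
    {T : Fin n → Fin (n + 1) → ℝ} {g ξ : Fin (n + 1) → ℝ} (hT : LinearIndependent ℝ T)
    (hgT : ∀ a, g ⬝ᵥ T a = 0) (hξ : g ⬝ᵥ ξ ≠ 0) (ζ : Fin (n + 1) → ℝ) :
    Ψ (Fin.cons ζ T : Fin (n + 1) → Fin (n + 1) → ℝ) * g ⬝ᵥ ξ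
      = g ⬝ᵥ ζ * Ψ (Fin.cons ξ T : Fin (n + 1) → Fin (n + 1) → ℝ) := by
  obtain ⟨t, ht⟩ := exists_eq_sum_add_smul hT hgT hξ ζ
  have := map_update_eq_mul Ψ (Fin.cons ξ T : Fin (n + 1) → Fin (n + 1) → ℝ) 0
    (Fin.cons (g ⬝ᵥ ζ / g ⬝ᵥ ξ) t)
  rw [Fin.update_cons_zero] at this
  simp only [Fin.sum_univ_succ, Fin.cons_zero, Fin.cons_succ] at this
  rw [add_comm (_ • ξ), ← ht] at this
  rw [this]
  field_simp

/-- If `m N = q g` and `g` annihilates the vectors `T a`, the Gram matrix of the frame `(N, T)` is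
block diagonal. -/
theorem det_gram_cons {m : Matrix (Fin (n + 1)) (Fin (n + 1)) ℝ} {N g : Fin (n + 1) → ℝ} {q : ℝ}
    {T : Fin n → Fin (n + 1) → ℝ} (hmN : m *ᵥ N = q • g) (hgT : ∀ a, g ⬝ᵥ T a = 0) :
    (Matrix.of (Fin.cons N T : Fin (n + 1) → Fin (n + 1) → ℝ)).det ^ 2 * m.det
      = q * (g ⬝ᵥ N) * (Matrix.of fun a b => T a ⬝ᵥ (m *ᵥ T b)).det := by
  set B : Matrix (Fin (n + 1)) (Fin (n + 1)) ℝ :=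
    Matrix.of (Fin.cons N T : Fin (n + 1) → Fin (n + 1) → ℝ)
  have h1 : (B * m * Bᵀ).det = B.det ^ 2 * m.det := by
    rw [det_mul, det_mul, det_transpose]; ring
  have hentry : ∀ i j, (B * m * Bᵀ) i j = B i ⬝ᵥ (m *ᵥ B j) := by
    intro i j
    rw [Matrix.mul_assoc, Matrix.mul_apply_eq_vecMul]
    simp only [Matrix.mul_apply, Matrix.vecMul, dotProduct, mulVec, Matrix.transpose_apply]
  -- The entry `(i, 0)` is `B i ⬝ᵥ (m *ᵥ N) = q (B i ⬝ᵥ g)`, which vanishes on every row except that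
  -- of `N`. Expansion along column `0` leaves one term.
  rw [← h1, det_succ_column_zero, Finset.sum_eq_single 0]
  · rw [hentry]
    have : (B * m * Bᵀ).submatrix (Fin.succAbove 0) Fin.succ
        = Matrix.of fun a b => T a ⬝ᵥ (m *ᵥ T b) := by
      ext a b
      rw [submatrix_apply, hentry]
      rfl
    rw [this]
    have : B 0 = N := rfl
    rw [this, hmN, dotProduct_smul, dotProduct_comm]
    simp
  · intro i _ hi
    obtain ⟨a, rfl⟩ := Fin.exists_succ_eq.2 hi
    have h2 : B a.succ = T a := rfl
    have h3 : B 0 = N := rfl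
    rw [hentry, h2, h3, hmN, dotProduct_smul, dotProduct_comm, hgT]
    simp
  · simp

end LinearAlgebra

/-! ### The tensors attached to a function at a point -/

section TensorIdentities

open Matrix

variable {n : ℕ} {Ψ : (Fin (n + 1) → ℝ) [⋀^Fin (n + 1)]→ₗ[ℝ] ℝ} {F : (Fin (n + 1) → ℝ) → ℝ}
  {q : (Fin (n + 1) → ℝ) → ℝ} {x : Fin (n + 1) → ℝ}

theorem vecMulVec_self_mulVec {ι : Type*} [Fintype ι] (s : ℝ) (u v y : ι → ℝ) :
    (s • vecMulVec u v) *ᵥ y = (s * (v ⬝ᵥ y)) • u := by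
  rw [smul_mulVec, vecMulVec_mulVec, ← smul_smul]
  congr 1
  ext i
  simp [mul_comm]

theorem dF_dotProduct_fieldN : dF F x ⬝ᵥ fieldN Ψ F x = opU Ψ F x := dotProduct_comm _ _

theorem dF_ne_zero (hU : opU Ψ F x ≠ 0) : dF F x ≠ 0 := by
  intro h
  simp [opU, h] at hU

theorem hess_mulVec_fieldN : hess F x *ᵥ fieldN Ψ F x = hessDet Ψ F x • dF F x := by
  rw [fieldN, adjTensor, mulVec_mulVec, mul_smul_comm, mul_adjugate, hessDet, smul_smul,
    smul_mulVec, one_mulVec, div_eq_inv_mul]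

/-- Exhibits `m` as a rank-one perturbation of the Hessian, the form needed for the matrix
determinant lemma. -/
theorem tensorM_eq :
    tensorM Ψ F q x = hess F x + ((opU Ψ F x)⁻¹ * (q x - hessDet Ψ F x)) •
      vecMulVec (dF F x) (dF F x) := by
  rw [tensorM, tensorPi, sub_add, ← sub_smul, sub_eq_add_neg, ← neg_smul]
  congr 2
  ring

theorem tensorM_mulVec (y : Fin (n + 1) → ℝ) :
    tensorM Ψ F q x *ᵥ y = hess F x *ᵥ y +
      ((opU Ψ F x)⁻¹ * (q x - hessDet Ψ F x) * (dF F x ⬝ᵥ y)) • dF F x := by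
  rw [tensorM_eq, add_mulVec, vecMulVec_self_mulVec]

theorem tensorM_mulVec_fieldN (hU : opU Ψ F x ≠ 0) :
    tensorM Ψ F q x *ᵥ fieldN Ψ F x = q x • dF F x := by
  rw [tensorM_mulVec, hess_mulVec_fieldN, dF_dotProduct_fieldN, ← add_smul]
  congr 1
  field_simp
  ring

/-- Since `dF ⬝ᵥ adj(Hess F) dF = c² U`, the rank-one term contributes `c² (q - H)`, and `c² H` is
the determinant of the Hessian itself. -/
theorem det_tensorM (hΨ : Ψ ≠ 0) (hU : opU Ψ F x ≠ 0) :
    (tensorM Ψ F q x).det = volCoeff Ψ ^ 2 * q x := by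
  have hc := volCoeff_ne_zero hΨ
  have h : dF F x ⬝ᵥ ((hess F x).adjugate *ᵥ dF F x) = volCoeff Ψ ^ 2 * opU Ψ F x := by
    rw [← dF_dotProduct_fieldN, fieldN, adjTensor, smul_mulVec, dotProduct_smul, smul_eq_mul]
    field_simp
  rw [tensorM_eq, det_add_smul_vecMulVec, h, hessDet]
  field_simp
  ring

theorem isUnit_det_tensorM (hΨ : Ψ ≠ 0) (hU : opU Ψ F x ≠ 0) (hq : q x ≠ 0) :
    IsUnit (tensorM Ψ F q x).det := by
  rw [det_tensorM hΨ hU]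
  exact isUnit_iff_ne_zero.2 (mul_ne_zero (pow_ne_zero _ (volCoeff_ne_zero hΨ)) hq)

theorem isSymm_tensorM (hs : (hess F x).IsSymm) : (tensorM Ψ F q x).IsSymm := by
  rw [tensorM_eq]
  refine hs.add (IsSymm.smul ?_ _)
  rw [IsSymm, transpose_vecMulVec]

theorem tensorPiUp_mulVec (y : Fin (n + 1) → ℝ) :
    tensorPiUp Ψ F q x *ᵥ y = (tensorM Ψ F q x)⁻¹ *ᵥ y -
      ((q x)⁻¹ * (opU Ψ F x)⁻¹ * (fieldN Ψ F x ⬝ᵥ y)) • fieldN Ψ F x := by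
  rw [tensorPiUp, sub_mulVec, vecMulVec_self_mulVec]

/-- By symmetry of `m` and `m N = q dF`, pairing `dF` with `m⁻¹ y` gives `q⁻¹ (N ⬝ᵥ y)`. The
correction term in `Π^{ij}` removes exactly this, as `dF(N) = U`. -/
theorem dF_dotProduct_tensorPiUp_mulVec (hΨ : Ψ ≠ 0) (hs : (hess F x).IsSymm)
    (hU : opU Ψ F x ≠ 0) (hq : q x ≠ 0) (y : Fin (n + 1) → ℝ) :
    dF F x ⬝ᵥ (tensorPiUp Ψ F q x *ᵥ y) = 0 := by
  have hm := isUnit_det_tensorM hΨ hU hq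
  have h1 : (tensorM Ψ F q x)⁻¹ *ᵥ dF F x = (q x)⁻¹ • fieldN Ψ F x := by
    have := congrArg (fun z => (q x)⁻¹ • ((tensorM Ψ F q x)⁻¹ *ᵥ z))
      (tensorM_mulVec_fieldN (q := q) hU)
    simp only [mulVec_mulVec, nonsing_inv_mul _ hm, one_mulVec, mulVec_smul, smul_smul,
      inv_mul_cancel₀ hq, one_smul] at this
    exact this.symm
  have h2 : dF F x ⬝ᵥ ((tensorM Ψ F q x)⁻¹ *ᵥ y) = (q x)⁻¹ * (fieldN Ψ F x ⬝ᵥ y) := by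
    rw [dotProduct_mulVec, ← mulVec_transpose, transpose_nonsing_inv, (isSymm_tensorM hs).eq, h1,
      smul_dotProduct, smul_eq_mul]
  rw [tensorPiUp_mulVec, dotProduct_sub, h2, dotProduct_smul, dF_dotProduct_fieldN, smul_eq_mul]
  field_simp
  ring

/-- On the kernel of `dF`, where `Π^{ij}` takes its values, the Hessian and `m` agree; and `m` maps
`Π^{ij} y_j` to `y` minus a multiple of `dF`, invisible to tangent `v`. -/
theorem tangent_dotProduct_hess_tensorPiUp_mulVec (hΨ : Ψ ≠ 0)
    (hU : opU Ψ F x ≠ 0) (hq : q x ≠ 0) {v : Fin (n + 1) → ℝ} (hv : dF F x ⬝ᵥ v = 0)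
    (hg : ∀ y, dF F x ⬝ᵥ (tensorPiUp Ψ F q x *ᵥ y) = 0) (y : Fin (n + 1) → ℝ) :
    v ⬝ᵥ (hess F x *ᵥ (tensorPiUp Ψ F q x *ᵥ y)) = v ⬝ᵥ y := by
  have hm := isUnit_det_tensorM hΨ hU hq
  have h1 : hess F x *ᵥ (tensorPiUp Ψ F q x *ᵥ y)
      = tensorM Ψ F q x *ᵥ (tensorPiUp Ψ F q x *ᵥ y) := by
    rw [tensorM_mulVec, hg, mul_zero, zero_smul, add_zero]
  rw [h1, tensorPiUp_mulVec, mulVec_sub, mulVec_mulVec, mul_nonsing_inv _ hm, one_mulVec,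
    mulVec_smul, tensorM_mulVec_fieldN hU, dotProduct_sub, dotProduct_smul, dotProduct_smul,
    dotProduct_comm v (dF F x), hv]
  simp

/-- The weight `|U(F)|^{1/(n+2)}`. -/
def weight (Ψ : (Fin (n + 1) → ℝ) [⋀^Fin (n + 1)]→ₗ[ℝ] ℝ) (F : (Fin (n + 1) → ℝ) → ℝ)
    (x : Fin (n + 1) → ℝ) : ℝ :=
  |opU Ψ F x| ^ (1 / ((n : ℝ) + 2))

theorem weight_pos (hU : opU Ψ F x ≠ 0) : 0 < weight Ψ F x :=
  Real.rpow_pos_of_pos (abs_pos.2 hU) _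

theorem weight_pow (Ψ : (Fin (n + 1) → ℝ) [⋀^Fin (n + 1)]→ₗ[ℝ] ℝ) (F : (Fin (n + 1) → ℝ) → ℝ)
    (x : Fin (n + 1) → ℝ) : weight Ψ F x ^ (n + 2) = |opU Ψ F x| := by
  rw [weight, one_div, ← Nat.cast_ofNat (R := ℝ), ← Nat.cast_add,
    Real.rpow_inv_natCast_pow (abs_nonneg _) (by omega)]

theorem dF_dotProduct_fieldNu (hΨ : Ψ ≠ 0) (hs : (hess F x).IsSymm)
    (hU : opU Ψ F x ≠ 0) (hq : q x ≠ 0) : dF F x ⬝ᵥ fieldNu Ψ F q x = -weight Ψ F x := by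
  rw [fieldNu, dotProduct_sub, dotProduct_neg, dotProduct_smul, dF_dotProduct_fieldN, tensorKUp,
    smul_mulVec, dotProduct_smul, dF_dotProduct_tensorPiUp_mulVec hΨ hs hU hq, smul_eq_mul,
    smul_zero, sub_zero, mul_assoc, inv_mul_cancel₀ hU, mul_one, weight]

/-- The defining property of `ν` within its tangential class: `F_{ij} ν^j ≡ -|U|^{1/(n+2)} μ_i`
on the tangent space of the level set. -/
theorem tangent_dotProduct_hess_fieldNu (hΨ : Ψ ≠ 0) (hs : (hess F x).IsSymm)
    (hU : opU Ψ F x ≠ 0) (hq : q x ≠ 0) {v : Fin (n + 1) → ℝ} (hv : dF F x ⬝ᵥ v = 0) :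
    v ⬝ᵥ (hess F x *ᵥ fieldNu Ψ F q x) = -(weight Ψ F x * v ⬝ᵥ mu Ψ F x) := by
  rw [fieldNu, mulVec_sub, mulVec_neg, mulVec_smul, hess_mulVec_fieldN, tensorKUp, smul_mulVec,
    mulVec_smul, dotProduct_sub, dotProduct_neg, dotProduct_smul, dotProduct_smul, dotProduct_smul,
    dotProduct_comm v (dF F x), hv, tangent_dotProduct_hess_tensorPiUp_mulVec hΨ hU hq hv
      (dF_dotProduct_tensorPiUp_mulVec hΨ hs hU hq)]
  simp [weight]

/-- The matrix of the restriction of the Hessian to the span of the vectors `T a`. -/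
def tangentHess (F : (Fin (n + 1) → ℝ) → ℝ) (x : Fin (n + 1) → ℝ) (T : Fin n → Fin (n + 1) → ℝ) :
    Matrix (Fin n) (Fin n) ℝ :=
  Matrix.of fun a b => T a ⬝ᵥ (hess F x *ᵥ T b)

theorem sq_apply_cons_fieldN (hΨ : Ψ ≠ 0) (hU : opU Ψ F x ≠ 0) {T : Fin n → Fin (n + 1) → ℝ}
    (hgT : ∀ a, dF F x ⬝ᵥ T a = 0) :
    Ψ (Fin.cons (fieldN Ψ F x) T : Fin (n + 1) → Fin (n + 1) → ℝ) ^ 2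
      = opU Ψ F x * (tangentHess F x T).det := by
  -- The statement does not involve `q`, so `q = 1` is chosen; on tangent vectors `m` reduces to the
  -- Hessian.
  have h := det_gram_cons (tensorM_mulVec_fieldN (q := fun _ => 1) hU) hgT
  have h1 : (Matrix.of fun a b => T a ⬝ᵥ (tensorM Ψ F (fun _ => 1) x *ᵥ T b))
      = tangentHess F x T := by
    ext a b
    simp [tangentHess, tensorM_mulVec, hgT]
  rw [h1, dF_dotProduct_fieldN, det_tensorM hΨ hU] at h
  rw [apply_eq_volCoeff_mul_det]
  linear_combination h

theorem sq_apply_cons (hΨ : Ψ ≠ 0) (hU : opU Ψ F x ≠ 0) {T : Fin n → Fin (n + 1) → ℝ}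
    (hT : LinearIndependent ℝ T) (hgT : ∀ a, dF F x ⬝ᵥ T a = 0) (ξ : Fin (n + 1) → ℝ) :
    Ψ (Fin.cons ξ T : Fin (n + 1) → Fin (n + 1) → ℝ) ^ 2 * opU Ψ F x
      = (dF F x ⬝ᵥ ξ) ^ 2 * (tangentHess F x T).det := by
  have h1 := sq_apply_cons_fieldN hΨ hU hgT
  have h2 := apply_cons_mul_dotProduct Ψ hT hgT
    (by rwa [dF_dotProduct_fieldN] : dF F x ⬝ᵥ fieldN Ψ F x ≠ 0) ξ
  rw [dF_dotProduct_fieldN] at h2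
  -- The claim times `U` is the square of `h2` combined with the case `ξ = N`.
  apply mul_right_cancel₀ hU
  linear_combination (Ψ (Fin.cons ξ T : Fin (n + 1) → Fin (n + 1) → ℝ) * opU Ψ F x
    + dF F x ⬝ᵥ ξ * Ψ (Fin.cons (fieldN Ψ F x) T : Fin (n + 1) → Fin (n + 1) → ℝ)) * h2
    + (dF F x ⬝ᵥ ξ) ^ 2 * h1

/-- Nondegeneracy of the level set comes from `U ≠ 0` alone: `(N, T)` is a frame, so its volume is
nonzero. -/
theorem det_tangentHess_ne_zero (hΨ : Ψ ≠ 0) (hU : opU Ψ F x ≠ 0) {T : Fin n → Fin (n + 1) → ℝ}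
    (hT : LinearIndependent ℝ T) (hgT : ∀ a, dF F x ⬝ᵥ T a = 0) :
    (tangentHess F x T).det ≠ 0 := by
  have hN : dF F x ⬝ᵥ fieldN Ψ F x ≠ 0 := by rwa [dF_dotProduct_fieldN]
  have h1 := sq_apply_cons_fieldN hΨ hU hgT
  have h2 := apply_cons_ne_zero hΨ hT hgT hN
  intro h
  rw [h, mul_zero] at h1
  exact h2 (pow_eq_zero_iff (two_ne_zero) |>.1 h1)

/-- With `h = -(ξ F)⁻¹ Hess F` the two volume densities agree exactly if `|ξ F| = |U|^{1/(n+2)}`. -/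
theorem density_eq_iff (hΨ : Ψ ≠ 0) (hU : opU Ψ F x ≠ 0) {T : Fin n → Fin (n + 1) → ℝ}
    (hT : LinearIndependent ℝ T) (hgT : ∀ a, dF F x ⬝ᵥ T a = 0) {ξ : Fin (n + 1) → ℝ}
    (hξ : dF F x ⬝ᵥ ξ < 0) :
    |Ψ (Fin.cons ξ T : Fin (n + 1) → Fin (n + 1) → ℝ)|
        = √|((-(dF F x ⬝ᵥ ξ)⁻¹) • tangentHess F x T).det|
      ↔ dF F x ⬝ᵥ ξ = -weight Ψ F x := by
  set l := -(dF F x ⬝ᵥ ξ) with hl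
  have hlpos : 0 < l := by linarith
  have hd := det_tangentHess_ne_zero hΨ hU hT hgT
  have h := sq_apply_cons hΨ hU hT hgT ξ
  set P := Ψ (Fin.cons ξ T : Fin (n + 1) → Fin (n + 1) → ℝ)
  set d := (tangentHess F x T).det
  have hU' := abs_pos.2 hU
  have hd' := abs_pos.2 hd
  have habs : P ^ 2 * |opU Ψ F x| = l ^ 2 * |d| := by
    have := congrArg abs h
    rw [abs_mul, abs_mul, abs_of_nonneg (sq_nonneg P), abs_of_nonneg (sq_nonneg (dF F x ⬝ᵥ ξ))] at this
    rw [this, hl]; ring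
  have hdet : |((-(dF F x ⬝ᵥ ξ)⁻¹) • tangentHess F x T).det| = (l ^ n)⁻¹ * |d| := by
    rw [det_smul, Fintype.card_fin, abs_mul, ← inv_neg, ← hl, inv_pow,
      abs_of_pos (inv_pos.2 (pow_pos hlpos n))]
  rw [hdet, eq_comm (a := |P|), Real.sqrt_eq_iff_eq_sq (by positivity) (abs_nonneg _), sq_abs]
  -- The exponent `n + 2` collects `l²` from the volume of the frame and `lⁿ` from scaling an `n ×
  -- n` determinant.
  have hiff : (l ^ n)⁻¹ * |d| = P ^ 2 ↔ l ^ (n + 2) = weight Ψ F x ^ (n + 2) := by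
    rw [weight_pow]
    constructor
    · intro e
      rw [← e] at habs
      field_simp at habs
      rw [pow_add]
      exact habs.symm
    · intro e
      rw [← e] at habs
      apply mul_right_cancel₀ (pow_pos hlpos (n + 2)).ne'
      rw [habs, pow_add]
      field_simp
  rw [hiff, pow_left_inj₀ hlpos.le (weight_pos hU).le (by omega)]
  constructor <;> intro e <;> linarith

end TensorIdentities

/-! ### Calculus -/

section Calculus

open Matrix

variable {k n : ℕ}

theorem fderiv_apply_eq_sum_pd {E : Type*} [NormedAddCommGroup E] [NormedSpace ℝ E]
    (f : (Fin k → ℝ) → E) (x v : Fin k → ℝ) : fderiv ℝ f x v = ∑ i, v i • pd f i x := by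
  conv_lhs => rw [pi_eq_sum_univ' v]
  simp [pd, map_sum]

theorem contDiffOn_pd {E : Type*} [NormedAddCommGroup E] [NormedSpace ℝ E]
    {f : (Fin k → ℝ) → E} {s : Set (Fin k → ℝ)} (hs : IsOpen s) (hf : ContDiffOn ℝ ∞ f s)
    (i : Fin k) : ContDiffOn ℝ ∞ (fun x => pd f i x) s :=
  (hf.fderiv_of_isOpen hs (m := ∞) (by simp)).clm_apply contDiffOn_const

theorem pd_congr_of_eqOn {E : Type*} [NormedAddCommGroup E] [NormedSpace ℝ E]
    {f g : (Fin k → ℝ) → E} {s : Set (Fin k → ℝ)} (hs : IsOpen s) (h : Set.EqOn f g s)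
    {x : Fin k → ℝ} (hx : x ∈ s) (i : Fin k) : pd f i x = pd g i x := by
  rw [pd, pd, (h.eventuallyEq_of_mem (hs.mem_nhds hx)).fderiv_eq]

theorem pd_const {E : Type*} [NormedAddCommGroup E] [NormedSpace ℝ E] (c : E) (i : Fin k)
    (x : Fin k → ℝ) : pd (fun _ => c) i x = 0 := by
  simp [pd]

theorem pd_comp {E : Type*} [NormedAddCommGroup E] [NormedSpace ℝ E]
    {f : (Fin n → ℝ) → E} {φ : (Fin k → ℝ) → (Fin n → ℝ)} {w : Fin k → ℝ}
    (hf : DifferentiableAt ℝ f (φ w)) (hφ : DifferentiableAt ℝ φ w) (a : Fin k) :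
    pd (fun v => f (φ v)) a w = ∑ i, pd φ a w i • pd f i (φ w) := by
  rw [← fderiv_apply_eq_sum_pd]
  simp only [pd]
  rw [show (fun v => f (φ v)) = f ∘ φ from rfl, fderiv_comp _ hf hφ]
  rfl

theorem pd_apply {Y : (Fin k → ℝ) → (Fin n → ℝ)} {w : Fin k → ℝ} (hY : DifferentiableAt ℝ Y w)
    (a : Fin k) (j : Fin n) : pd (fun v => Y v j) a w = pd Y a w j := by
  simp only [pd]
  rw [((hasFDerivAt_pi'.1 hY.hasFDerivAt) j).fderiv]
  rfl

theorem contDiffOn_det {ι E : Type*} [Fintype ι] [DecidableEq ι] [NormedAddCommGroup E]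
    [NormedSpace ℝ E] {M : E → Matrix ι ι ℝ} {s : Set E}
    (hM : ∀ i j, ContDiffOn ℝ ∞ (fun x => M x i j) s) : ContDiffOn ℝ ∞ (fun x => (M x).det) s := by
  simp only [det_apply']
  exact ContDiffOn.sum fun σ _ => contDiffOn_const.mul (contDiffOn_prod fun i _ => hM _ _)

theorem contDiffOn_adjugate {ι E : Type*} [Fintype ι] [DecidableEq ι] [NormedAddCommGroup E]
    [NormedSpace ℝ E] {M : E → Matrix ι ι ℝ} {s : Set E}
    (hM : ∀ i j, ContDiffOn ℝ ∞ (fun x => M x i j) s) (i j : ι) :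
    ContDiffOn ℝ ∞ (fun x => (M x).adjugate i j) s := by
  simp only [adjugate_apply]
  refine contDiffOn_det fun a b => ?_
  by_cases h : a = j
  · subst h
    simpa using contDiffOn_const
  · simpa [updateRow_ne h] using hM a b

theorem contDiffOn_dotProduct {ι E : Type*} [Fintype ι] [NormedAddCommGroup E]
    [NormedSpace ℝ E] {u v : E → ι → ℝ} {s : Set E}
    (hu : ∀ i, ContDiffOn ℝ ∞ (fun x => u x i) s) (hv : ∀ i, ContDiffOn ℝ ∞ (fun x => v x i) s) :
    ContDiffOn ℝ ∞ (fun x => u x ⬝ᵥ v x) s :=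
  ContDiffOn.sum fun i _ => (hu i).mul (hv i)

theorem contDiffOn_mulVec {ι E : Type*} [Fintype ι] [NormedAddCommGroup E]
    [NormedSpace ℝ E] {M : E → Matrix ι ι ℝ} {v : E → ι → ℝ} {s : Set E}
    (hM : ∀ i j, ContDiffOn ℝ ∞ (fun x => M x i j) s) (hv : ∀ i, ContDiffOn ℝ ∞ (fun x => v x i) s)
    (i : ι) : ContDiffOn ℝ ∞ (fun x => (M x *ᵥ v x) i) s :=
  contDiffOn_dotProduct (hM i) hv

end Calculus

/-! ### Smoothness of the tensors as functions of the point -/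

section Smoothness

open Matrix

variable {n : ℕ} {Ψ : (Fin (n + 1) → ℝ) [⋀^Fin (n + 1)]→ₗ[ℝ] ℝ} {F : (Fin (n + 1) → ℝ) → ℝ}
  {q : (Fin (n + 1) → ℝ) → ℝ} {s : Set (Fin (n + 1) → ℝ)}

theorem contDiffOn_dF (hs : IsOpen s) (hF : ContDiffOn ℝ ∞ F s) (i : Fin (n + 1)) :
    ContDiffOn ℝ ∞ (fun x => dF F x i) s :=
  contDiffOn_pd hs hF i

theorem contDiffOn_hess (hs : IsOpen s) (hF : ContDiffOn ℝ ∞ F s) (i j : Fin (n + 1)) :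
    ContDiffOn ℝ ∞ (fun x => hess F x i j) s :=
  contDiffOn_pd hs (contDiffOn_pd hs hF j) i

theorem isSymm_hess (hs : IsOpen s) (hF : ContDiffOn ℝ ∞ F s) {x : Fin (n + 1) → ℝ} (hx : x ∈ s) :
    (hess F x).IsSymm := by
  have hFx : ContDiffAt ℝ ∞ F x := hF.contDiffAt (hs.mem_nhds hx)
  have h2 : IsSymmSndFDerivAt ℝ F x := hFx.isSymmSndFDerivAt (by simpa using WithTop.coe_le_coe.2 (le_top (a := (2 : ℕ∞))))
  have hd : DifferentiableAt ℝ (fderiv ℝ F) x :=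
    ((hF.fderiv_of_isOpen hs (m := ∞) (by simp)).contDiffAt (hs.mem_nhds hx)).differentiableAt
      (by simp)
  have key : ∀ i j, hess F x i j = fderiv ℝ (fderiv ℝ F) x (Pi.single i 1) (Pi.single j 1) := by
    intro i j
    simp only [hess, of_apply, pd]
    rw [(hd.hasFDerivAt.clm_apply (hasFDerivAt_const _ _)).fderiv]
    simp
  ext i j
  rw [transpose_apply, key, key]
  exact h2 _ _

theorem contDiffOn_hessDet (hs : IsOpen s) (hF : ContDiffOn ℝ ∞ F s) :
    ContDiffOn ℝ ∞ (hessDet Ψ F) s :=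
  (contDiffOn_det (contDiffOn_hess hs hF)).div_const _

theorem contDiffOn_fieldN (hs : IsOpen s) (hF : ContDiffOn ℝ ∞ F s) (i : Fin (n + 1)) :
    ContDiffOn ℝ ∞ (fun x => fieldN Ψ F x i) s :=
  contDiffOn_mulVec
    (fun i j => contDiffOn_const.mul (contDiffOn_adjugate (contDiffOn_hess hs hF) i j))
    (contDiffOn_dF hs hF) i

theorem contDiffOn_opU (hs : IsOpen s) (hF : ContDiffOn ℝ ∞ F s) :
    ContDiffOn ℝ ∞ (opU Ψ F) s :=
  contDiffOn_dotProduct (contDiffOn_fieldN hs hF) (contDiffOn_dF hs hF)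

theorem contDiffOn_mu (hs : IsOpen s) (hF : ContDiffOn ℝ ∞ F s) (hU : ∀ x ∈ s, opU Ψ F x ≠ 0)
    (i : Fin (n + 1)) : ContDiffOn ℝ ∞ (fun x => mu Ψ F x i) s :=
  contDiffOn_const.mul (contDiffOn_pd hs ((contDiffOn_opU hs hF).log hU) i)

theorem contDiffOn_tensorM (hs : IsOpen s) (hF : ContDiffOn ℝ ∞ F s)
    (hU : ∀ x ∈ s, opU Ψ F x ≠ 0) (hq : ContDiffOn ℝ ∞ q s) (i j : Fin (n + 1)) :
    ContDiffOn ℝ ∞ (fun x => tensorM Ψ F q x i j) s := by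
  simp only [tensorM_eq]
  exact (contDiffOn_hess hs hF i j).add ((((contDiffOn_opU hs hF).inv hU).mul
    (hq.sub (contDiffOn_hessDet hs hF))).mul
      ((contDiffOn_dF hs hF i).mul (contDiffOn_dF hs hF j)))

theorem contDiffOn_inv_tensorM (hΨ : Ψ ≠ 0) (hs : IsOpen s) (hF : ContDiffOn ℝ ∞ F s)
    (hU : ∀ x ∈ s, opU Ψ F x ≠ 0) (hq : ContDiffOn ℝ ∞ q s) (hq0 : ∀ x ∈ s, q x ≠ 0)
    (i j : Fin (n + 1)) : ContDiffOn ℝ ∞ (fun x => (tensorM Ψ F q x)⁻¹ i j) s := by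
  simp only [Matrix.inv_def, Ring.inverse_eq_inv']
  exact ((contDiffOn_det (contDiffOn_tensorM hs hF hU hq)).inv
    fun x hx => (isUnit_det_tensorM hΨ (hU x hx) (hq0 x hx)).ne_zero).mul
      (contDiffOn_adjugate (contDiffOn_tensorM hs hF hU hq) i j)

theorem contDiffOn_tensorPiUp (hΨ : Ψ ≠ 0) (hs : IsOpen s) (hF : ContDiffOn ℝ ∞ F s)
    (hU : ∀ x ∈ s, opU Ψ F x ≠ 0) (hq : ContDiffOn ℝ ∞ q s) (hq0 : ∀ x ∈ s, q x ≠ 0)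
    (i j : Fin (n + 1)) : ContDiffOn ℝ ∞ (fun x => tensorPiUp Ψ F q x i j) s :=
  (contDiffOn_inv_tensorM hΨ hs hF hU hq hq0 i j).sub
    (((hq.inv hq0).mul ((contDiffOn_opU hs hF).inv hU)).mul
      ((contDiffOn_fieldN hs hF i).mul (contDiffOn_fieldN hs hF j)))

/-- Treats both signs of `U` at once, since `Real.log` ignores sign; smoothness and the derivative
of the weight are read off from this form. -/
theorem weight_eq_exp {x : Fin (n + 1) → ℝ} (hU : opU Ψ F x ≠ 0) :
    weight Ψ F x = Real.exp (((n : ℝ) + 2)⁻¹ * Real.log (opU Ψ F x)) := by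
  rw [weight, Real.rpow_def_of_pos (abs_pos.2 hU), Real.log_abs, one_div, mul_comm]

theorem contDiffOn_weight (hs : IsOpen s) (hF : ContDiffOn ℝ ∞ F s)
    (hU : ∀ x ∈ s, opU Ψ F x ≠ 0) : ContDiffOn ℝ ∞ (weight Ψ F) s :=
  (contDiffOn_const.mul ((contDiffOn_opU hs hF).log hU)).exp.congr fun x hx => weight_eq_exp (hU x hx)

/-- `d|U|^{1/(n+2)} = |U|^{1/(n+2)} μ`. -/
theorem pd_weight (hs : IsOpen s) (hF : ContDiffOn ℝ ∞ F s) (hU : ∀ x ∈ s, opU Ψ F x ≠ 0)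
    {x : Fin (n + 1) → ℝ} (hx : x ∈ s) (i : Fin (n + 1)) :
    pd (weight Ψ F) i x = weight Ψ F x * mu Ψ F x i := by
  rw [pd_congr_of_eqOn hs (fun y hy => weight_eq_exp (hU y hy)) hx]
  have hd : DifferentiableAt ℝ (fun y => Real.log (opU Ψ F y)) x :=
    (((contDiffOn_opU hs hF).log hU).contDiffAt (hs.mem_nhds hx)).differentiableAt (by simp)
  simp only [pd, mu]
  rw [((hd.hasFDerivAt.const_mul _).exp).fderiv, weight_eq_exp (hU x hx)]
  simp

theorem contDiffOn_fieldNu (hΨ : Ψ ≠ 0) (hs : IsOpen s) (hF : ContDiffOn ℝ ∞ F s)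
    (hU : ∀ x ∈ s, opU Ψ F x ≠ 0) (hq : ContDiffOn ℝ ∞ q s) (hq0 : ∀ x ∈ s, q x ≠ 0) :
    ContDiffOn ℝ ∞ (fieldNu Ψ F q) s := by
  rw [contDiffOn_pi]
  intro i
  have hw := contDiffOn_weight hs hF hU
  exact ((hw.mul ((contDiffOn_opU hs hF).inv hU)).mul (contDiffOn_fieldN hs hF i)).neg.sub
    (contDiffOn_mulVec (fun i j => hw.mul (contDiffOn_tensorPiUp hΨ hs hF hU hq hq0 i j))
      (contDiffOn_mu hs hF hU) i)

end Smoothness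

/-! ### Calculus along a patch of a level set -/

section Patch

open Matrix

variable {n : ℕ} {Ψ : (Fin (n + 1) → ℝ) [⋀^Fin (n + 1)]→ₗ[ℝ] ℝ} {F : (Fin (n + 1) → ℝ) → ℝ}
  {s : Set (Fin (n + 1) → ℝ)} {W : Set (Fin n → ℝ)} {φ : (Fin n → ℝ) → (Fin (n + 1) → ℝ)}
  {w : Fin n → ℝ} {r : ℝ}

theorem IsPatch.differentiableAt {S : Set (Fin (n + 1) → ℝ)} (hφ : IsPatch S W φ) (hw : w ∈ W) :
    DifferentiableAt ℝ φ w :=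
  (hφ.smooth.contDiffAt (hφ.isOpen.mem_nhds hw)).differentiableAt (by simp)

theorem IsPatch.differentiableAt_pd {S : Set (Fin (n + 1) → ℝ)} (hφ : IsPatch S W φ) (hw : w ∈ W)
    (b : Fin n) : DifferentiableAt ℝ (fun v => pd φ b v) w :=
  ((contDiffOn_pd hφ.isOpen hφ.smooth b).contDiffAt (hφ.isOpen.mem_nhds hw)).differentiableAt
    (by simp)

theorem pd_dF_dotProduct_comp (hs : IsOpen s) (hF : ContDiffOn ℝ ∞ F s)
    (hφ : DifferentiableAt ℝ φ w) (hw : φ w ∈ s) {Y : (Fin n → ℝ) → (Fin (n + 1) → ℝ)}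
    (hY : DifferentiableAt ℝ Y w) (a : Fin n) :
    pd (fun v => dF F (φ v) ⬝ᵥ Y v) a w
      = pd φ a w ⬝ᵥ (hess F (φ w) *ᵥ Y w) + dF F (φ w) ⬝ᵥ pd Y a w := by
  have hg : ∀ j, DifferentiableAt ℝ (fun x => dF F x j) (φ w) := fun j =>
    ((contDiffOn_dF hs hF j).contDiffAt (hs.mem_nhds hw)).differentiableAt (by simp)
  have hgφ : ∀ j, DifferentiableAt ℝ (fun v => dF F (φ v) j) w := fun j =>
    (hg j).comp w hφ
  have hYj : ∀ j, DifferentiableAt ℝ (fun v => Y v j) w := fun j => differentiableAt_pi.1 hY j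
  have h1 : pd (fun v => dF F (φ v) ⬝ᵥ Y v) a w
      = ∑ j, (pd (fun v => dF F (φ v) j) a w * Y w j + dF F (φ w) j * pd Y a w j) := by
    simp only [pd, dotProduct]
    rw [fderiv_fun_sum fun j _ => (hgφ j).fun_mul (hYj j), _root_.sum_apply]
    refine Finset.sum_congr rfl fun j _ => ?_
    have := pd_apply hY a j
    simp only [pd] at this
    rw [fderiv_fun_mul (hgφ j) (hYj j)]
    simp only [_root_.add_apply, _root_.smul_apply, smul_eq_mul, this]
    ring
  rw [h1, Finset.sum_add_distrib]
  congr 1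
  have h2 : ∀ j, pd (fun v => dF F (φ v) j) a w = (pd φ a w ᵥ* hess F (φ w)) j := by
    intro j
    rw [pd_comp (f := fun x => dF F x j) (hg j) hφ]
    rfl
  rw [dotProduct_mulVec]
  simp only [h2]
  rfl

theorem dF_dotProduct_pd_patch (hs : IsOpen s) (hF : ContDiffOn ℝ ∞ F s)
    (hφ : IsPatch {x | x ∈ s ∧ F x = r} W φ) (hw : w ∈ W) (a : Fin n) :
    dF F (φ w) ⬝ᵥ pd φ a w = 0 := by
  have hd : DifferentiableAt ℝ F (φ w) :=
    (hF.contDiffAt (hs.mem_nhds (hφ.mapsTo hw).1)).differentiableAt (by simp)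
  have h1 := pd_comp hd (hφ.differentiableAt hw) a
  rw [pd_congr_of_eqOn hφ.isOpen (g := fun _ => r) (fun v hv => (hφ.mapsTo hv).2) hw,
    pd_const] at h1
  rw [dotProduct_comm]
  exact h1.symm

theorem dF_dotProduct_pd_pd_patch (hs : IsOpen s) (hF : ContDiffOn ℝ ∞ F s)
    (hφ : IsPatch {x | x ∈ s ∧ F x = r} W φ) (hw : w ∈ W) (a b : Fin n) :
    dF F (φ w) ⬝ᵥ pd (fun v => pd φ b v) a w
      = -tangentHess F (φ w) (fun c => pd φ c w) a b := by
  have h := pd_dF_dotProduct_comp hs hF (hφ.differentiableAt hw) (hφ.mapsTo hw).1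
    (hφ.differentiableAt_pd hw b) a
  rw [pd_congr_of_eqOn hφ.isOpen (g := fun _ => 0)
    (fun v hv => dF_dotProduct_pd_patch hs hF hφ hv b) hw, pd_const] at h
  simp only [tangentHess, of_apply]
  linarith

/-- The second fundamental form of a level set is `-(ξF)⁻¹ Hess F`. -/
theorem secondFundamentalForm_eq (hs : IsOpen s) (hF : ContDiffOn ℝ ∞ F s)
    (hφ : IsPatch {x | x ∈ s ∧ F x = r} W φ) (hw : w ∈ W)
    {ξ : (Fin (n + 1) → ℝ) → (Fin (n + 1) → ℝ)} (hξ : dF F (φ w) ⬝ᵥ ξ (φ w) ≠ 0)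
    {Γ : (Fin n → ℝ) → Fin n → Fin n → Fin n → ℝ} {h : (Fin n → ℝ) → Matrix (Fin n) (Fin n) ℝ}
    (hG : GaussFormula W φ ξ Γ h) :
    h w = (-(dF F (φ w) ⬝ᵥ ξ (φ w))⁻¹) • tangentHess F (φ w) (fun c => pd φ c w) := by
  ext a b
  have h1 := dF_dotProduct_pd_pd_patch hs hF hφ hw a b
  rw [hG w hw a b, dotProduct_add, dotProduct_sum, dotProduct_smul] at h1
  simp only [dotProduct_smul, dF_dotProduct_pd_patch hs hF hφ hw, mul_zero,
    Finset.sum_const_zero, zero_add, smul_eq_mul] at h1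
  rw [Matrix.smul_apply, smul_eq_mul]
  field_simp
  linarith

theorem exists_gaussFormula (hs : IsOpen s) (hF : ContDiffOn ℝ ∞ F s)
    (hφ : IsPatch {x | x ∈ s ∧ F x = r} W φ) {ξ : (Fin (n + 1) → ℝ) → (Fin (n + 1) → ℝ)}
    (hξ : ∀ w ∈ W, dF F (φ w) ⬝ᵥ ξ (φ w) ≠ 0) :
    ∃ Γ h, GaussFormula W φ ξ Γ h := by
  have key : ∀ w, ∃ t : Fin n → Fin n → Fin n → ℝ, w ∈ W → ∀ a b,
      pd (fun v => pd φ b v) a w = ∑ c, t a b c • pd φ c w +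
        (dF F (φ w) ⬝ᵥ pd (fun v => pd φ b v) a w / dF F (φ w) ⬝ᵥ ξ (φ w)) • ξ (φ w) := by
    intro w
    by_cases hw : w ∈ W
    · choose t ht using fun a b => exists_eq_sum_add_smul (hφ.immersion w hw)
        (dF_dotProduct_pd_patch hs hF hφ hw) (hξ w hw) (pd (fun v => pd φ b v) a w)
      exact ⟨t, fun _ => ht⟩
    · exact ⟨0, fun h => absurd h hw⟩
  choose Γ hΓ using key
  exact ⟨Γ, fun w => Matrix.of fun a b =>
    dF F (φ w) ⬝ᵥ pd (fun v => pd φ b v) a w / dF F (φ w) ⬝ᵥ ξ (φ w), hΓ⟩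

theorem continuous_alternatingMap (Ψ : (Fin (n + 1) → ℝ) [⋀^Fin (n + 1)]→ₗ[ℝ] ℝ) :
    Continuous Ψ := by
  have : ⇑Ψ = fun v => volCoeff Ψ * (Matrix.of v).det :=
    funext fun v => apply_eq_volCoeff_mul_det Ψ v
  rw [this]
  exact continuous_const.mul (Continuous.matrix_det continuous_id)

theorem pd_alternatingMap_comp (Ψ : (Fin (n + 1) → ℝ) [⋀^Fin (n + 1)]→ₗ[ℝ] ℝ)
    {v : Fin (n + 1) → (Fin n → ℝ) → (Fin (n + 1) → ℝ)} (hv : ∀ i, DifferentiableAt ℝ (v i) w) :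
    DifferentiableAt ℝ (fun u => Ψ fun i => v i u) w ∧
      ∀ a, pd (fun u => Ψ fun i => v i u) a w
        = ∑ i, Ψ (Function.update (fun i => v i w) i (pd (v i) a w)) := by
  let Φ : ContinuousMultilinearMap ℝ (fun _ : Fin (n + 1) => Fin (n + 1) → ℝ) ℝ :=
    { Ψ.toMultilinearMap with cont := continuous_alternatingMap Ψ }
  have h := HasFDerivAt.multilinear_comp (f := Φ) (fun i => (hv i).hasFDerivAt)
  refine ⟨h.differentiableAt, fun a => ?_⟩
  have h' : fderiv ℝ (fun u => Ψ fun i => v i u) w = _ := h.fderiv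
  rw [pd, h', _root_.sum_apply]
  rfl

/-- Covariant derivative of the induced density: the discrepancy from being parallel is the
transversal component of `D ξ`. -/
theorem pd_inducedDensity (hΨ : Ψ ≠ 0) (hs : IsOpen s) (hF : ContDiffOn ℝ ∞ F s)
    (hφ : IsPatch {x | x ∈ s ∧ F x = r} W φ) (hw : w ∈ W)
    {ξ : (Fin (n + 1) → ℝ) → (Fin (n + 1) → ℝ)} (hξ : dF F (φ w) ⬝ᵥ ξ (φ w) ≠ 0)
    (hξd : DifferentiableAt ℝ (fun v => ξ (φ v)) w)
    {Γ : (Fin n → ℝ) → Fin n → Fin n → Fin n → ℝ} {h : (Fin n → ℝ) → Matrix (Fin n) (Fin n) ℝ}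
    (hG : GaussFormula W φ ξ Γ h) :
    DifferentiableAt ℝ (inducedDensity Ψ φ ξ) w ∧
      ∀ a, pd (inducedDensity Ψ φ ξ) a w
        = (∑ b, Γ w a b b + dF F (φ w) ⬝ᵥ pd (fun v => ξ (φ v)) a w / dF F (φ w) ⬝ᵥ ξ (φ w))
          * inducedDensity Ψ φ ξ w := by
  have hgT := dF_dotProduct_pd_patch hs hF hφ hw
  have hT := hφ.immersion w hw
  let v : Fin (n + 1) → (Fin n → ℝ) → (Fin (n + 1) → ℝ) :=
    Fin.cons (fun u => ξ (φ u)) (fun a u => pd φ a u)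
  have hvu : ∀ u, (fun i => v i u)
      = (Fin.cons (ξ (φ u)) (fun a => pd φ a u) : Fin (n + 1) → Fin (n + 1) → ℝ) := by
    intro u
    ext i : 1
    refine Fin.cases rfl (fun a => rfl) i
  have hv : ∀ i, DifferentiableAt ℝ (v i) w := fun i =>
    Fin.cases hξd (fun a => hφ.differentiableAt_pd hw a) i
  obtain ⟨hd, hpd⟩ := pd_alternatingMap_comp Ψ hv
  have hρ : inducedDensity Ψ φ ξ = fun u => |Ψ fun i => v i u| := by
    funext u
    rw [hvu]
    rfl
  have h0 : (Ψ fun i => v i w) ≠ 0 := by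
    rw [hvu]
    exact apply_cons_ne_zero hΨ hT hgT hξ
  have habs := hd.hasFDerivAt.abs h0
  rw [hρ]
  refine ⟨habs.differentiableAt, fun a => ?_⟩
  have hP : pd (fun u => Ψ fun i => v i u) a w
      = (∑ b, Γ w a b b + dF F (φ w) ⬝ᵥ pd (fun v => ξ (φ v)) a w / dF F (φ w) ⬝ᵥ ξ (φ w))
        * Ψ fun i => v i w := by
    rw [hpd, Fin.sum_univ_succ, add_comm, add_mul, Finset.sum_mul]
    congr 1
    · refine Finset.sum_congr rfl fun b _ => ?_
      -- In the slot of `∂_b φ` the Gauss formula expands `∂_a ∂_b φ` in the frame, and only the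
      -- coefficient `Γ_{ab}^b` survives alternation.
      have := map_update_eq_mul Ψ (fun i => v i w) b.succ (Fin.cons (h w a b) (Γ w a b))
      rw [Fin.sum_univ_succ] at this
      simp only [Fin.cons_zero, Fin.cons_succ] at this
      rw [← this]
      congr 2
      exact (hG w hw a b).trans (add_comm _ _)
    · obtain ⟨t, ht⟩ := exists_eq_sum_add_smul hT hgT hξ (pd (fun v => ξ (φ v)) a w)
      have := map_update_eq_mul Ψ (fun i => v i w) 0
        -- In the slot of `ξ` only the transversal component of `D_a ξ` survives.
        (Fin.cons (dF F (φ w) ⬝ᵥ pd (fun v => ξ (φ v)) a w / dF F (φ w) ⬝ᵥ ξ (φ w)) t)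
      rw [Fin.sum_univ_succ] at this
      simp only [Fin.cons_zero, Fin.cons_succ] at this
      rw [← this]
      congr 2
      exact ht.trans (add_comm _ _)
  have : pd (fun u => |Ψ fun i => v i u|) a w
      = SignType.sign (Ψ fun i => v i w) * pd (fun u => Ψ fun i => v i u) a w := by
    rw [pd, habs.fderiv]
    rfl
  rw [this, hP, mul_left_comm, sign_mul_self]

end Patch

/-! ### Level sets are hypersurfaces -/

section LevelSet

open Matrix

variable {n : ℕ} {F : (Fin (n + 1) → ℝ) → ℝ} {s : Set (Fin (n + 1) → ℝ)}

/-- The derivative of `x ↦ x + (F x - xᵢ) eᵢ` at a point where `dF = ℓ`, `ℓ eᵢ ≠ 0`. -/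
def straightenEquiv (i : Fin (n + 1)) (l : (Fin (n + 1) → ℝ) →L[ℝ] ℝ)
    (hl : l (Pi.single i 1) ≠ 0) : (Fin (n + 1) → ℝ) ≃L[ℝ] (Fin (n + 1) → ℝ) :=
  ContinuousLinearEquiv.equivOfInverse
    (ContinuousLinearMap.id ℝ _ +
      (l - ContinuousLinearMap.proj i).smulRight (Pi.single i (1 : ℝ) : Fin (n + 1) → ℝ))
    (ContinuousLinearMap.id ℝ _ +
      ((l (Pi.single i 1))⁻¹ • (ContinuousLinearMap.proj i - l)).smulRight
        (Pi.single i (1 : ℝ) : Fin (n + 1) → ℝ))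
    (by
      intro v
      simp only [_root_.add_apply, ContinuousLinearMap.id_apply,
        ContinuousLinearMap.smulRight_apply, _root_.sub_apply, ContinuousLinearMap.proj_apply,
        _root_.smul_apply, map_add, map_smul, Pi.single_eq_same, smul_eq_mul]
      ext b
      simp only [Pi.add_apply, Pi.smul_apply, smul_eq_mul]
      field_simp
      ring)
    (by
      intro v
      simp only [_root_.add_apply, ContinuousLinearMap.id_apply,
        ContinuousLinearMap.smulRight_apply, _root_.sub_apply, ContinuousLinearMap.proj_apply,
        _root_.smul_apply, map_add, map_smul, Pi.single_eq_same, smul_eq_mul]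
      ext b
      simp only [Pi.add_apply, Pi.smul_apply, smul_eq_mul]
      field_simp
      ring)

/-- The map replacing the `i`-th coordinate by the value of `F`. -/
def straighten (F : (Fin (n + 1) → ℝ) → ℝ) (i : Fin (n + 1)) (x : Fin (n + 1) → ℝ) :
    Fin (n + 1) → ℝ :=
  x + (F x - x i) • (Pi.single i (1 : ℝ) : Fin (n + 1) → ℝ)

theorem straighten_eq_insertNth (F : (Fin (n + 1) → ℝ) → ℝ) (i : Fin (n + 1))
    (x : Fin (n + 1) → ℝ) :
    straighten F i x = i.insertNth (F x) (fun a => x (i.succAbove a)) := by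
  ext j
  refine Fin.succAboveCases i ?_ (fun a => ?_) j
  · simp [straighten]
  · simp [straighten, Fin.succAbove_ne]

theorem hasFDerivAt_straighten {x : Fin (n + 1) → ℝ} (hF : DifferentiableAt ℝ F x)
    {i : Fin (n + 1)} (hi : fderiv ℝ F x (Pi.single i 1) ≠ 0) :
    HasFDerivAt (straighten F i)
      (straightenEquiv i (fderiv ℝ F x) hi : (Fin (n + 1) → ℝ) →L[ℝ] (Fin (n + 1) → ℝ)) x :=
  (hasFDerivAt_id x).add
    ((hF.hasFDerivAt.sub (ContinuousLinearMap.proj (R := ℝ) (φ := fun _ : Fin (n + 1) => ℝ)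
      i).hasFDerivAt).smul_const _)

theorem contDiffAt_straighten {x : Fin (n + 1) → ℝ} (hF : ContDiffAt ℝ ∞ F x)
    (i : Fin (n + 1)) : ContDiffAt ℝ ∞ (straighten F i) x :=
  contDiffAt_id.add ((hF.sub (contDiffAt_pi.1 contDiffAt_id i)).smul contDiffAt_const)

/-- A smooth map with a linear left inverse is an immersion. -/
theorem linearIndependent_pd_of_leftInverse {W : Set (Fin n → ℝ)} (hW : IsOpen W)
    {φ : (Fin n → ℝ) → (Fin (n + 1) → ℝ)} {w : Fin n → ℝ} (hw : w ∈ W)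
    (hφ : DifferentiableAt ℝ φ w) (L : (Fin (n + 1) → ℝ) →L[ℝ] (Fin n → ℝ))
    (hL : ∀ v ∈ W, L (φ v) = v) : LinearIndependent ℝ (fun a => pd φ a w) := by
  have h1 : HasFDerivAt (fun v => L (φ v)) (L ∘L fderiv ℝ φ w) w :=
    L.hasFDerivAt.comp w hφ.hasFDerivAt
  have h2 : HasFDerivAt (fun v => L (φ v)) (ContinuousLinearMap.id ℝ (Fin n → ℝ)) w :=
    (hasFDerivAt_id w).congr_of_eventuallyEq
      (Filter.eventuallyEq_of_mem (hW.mem_nhds hw) hL)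
  have h3 := h1.unique h2
  have h4 : L.toLinearMap ∘ (fun a => pd φ a w) = ⇑(Pi.basisFun ℝ (Fin n)) := by
    funext a
    rw [Pi.basisFun_apply]
    exact DFunLike.congr_fun h3 (Pi.single a 1)
  exact LinearIndependent.of_comp L.toLinearMap (h4 ▸ (Pi.basisFun ℝ (Fin n)).linearIndependent)

/-- Where `∂_i F ≠ 0`, replacing the `i`-th coordinate by `F` is a local diffeomorphism that
flattens the level set. Its inverse on the slice `F = r` is the patch, and forgetting the `i`-th
coordinate inverts the patch. -/
theorem isHypersurface_levelSet (hs : IsOpen s) (hF : ContDiffOn ℝ ∞ F s)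
    (hdF : ∀ x ∈ s, dF F x ≠ 0) (r : ℝ) : IsHypersurface {x | x ∈ s ∧ F x = r} := by
  intro p hp
  obtain ⟨i, hi⟩ := Function.ne_iff.1 (hdF p hp.1)
  have hi : fderiv ℝ F p (Pi.single i 1) ≠ 0 := hi
  have hFat : ∀ x ∈ s, ContDiffAt ℝ ∞ F x := fun x hx => hF.contDiffAt (hs.mem_nhds hx)
  have hdat : ∀ x ∈ s, DifferentiableAt ℝ F x := fun x hx => (hFat x hx).differentiableAt (by simp)
  -- The inverse function theorem yields smoothness of the inverse only at one point. Restricting to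
  -- `O` keeps the derivative invertible throughout, so the inverse is smooth on the whole target.
  set O : Set (Fin (n + 1) → ℝ) := s ∩ {x | fderiv ℝ F x (Pi.single i 1) ≠ 0} with hO
  have hOopen : IsOpen O :=
    (contDiffOn_dF hs hF i).continuousOn.isOpen_inter_preimage hs isOpen_ne
  let e₀ := (contDiffAt_straighten (hFat p hp.1) i).toOpenPartialHomeomorph (straighten F i)
    (hasFDerivAt_straighten (hdat p hp.1) hi) (by simp)
  let e := e₀.restrOpen O hOopen
  have he : ∀ x, e x = straighten F i x := fun x => rfl
  have hpe : p ∈ e.source :=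
    ⟨(contDiffAt_straighten (hFat p hp.1) i).mem_toOpenPartialHomeomorph_source _ _,
      hp.1, hi⟩
  have heO : e.source ⊆ O := fun x hx => hx.2
  let L : (Fin (n + 1) → ℝ) →L[ℝ] (Fin n → ℝ) :=
    ContinuousLinearMap.pi fun a => ContinuousLinearMap.proj (i.succAbove a)
  let j : (Fin n → ℝ) → (Fin (n + 1) → ℝ) := fun w => i.insertNth r w
  have hj : ContDiff ℝ ∞ j := by
    rw [contDiff_pi]
    intro b
    refine Fin.succAboveCases i ?_ (fun a => ?_) b
    · simpa [j] using contDiff_const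
    · simpa [j] using contDiff_apply ℝ ℝ a
  let W : Set (Fin n → ℝ) := j ⁻¹' e.target
  have hW : IsOpen W := e.open_target.preimage hj.continuous
  let φ : (Fin n → ℝ) → (Fin (n + 1) → ℝ) := fun w => e.symm (j w)
  have hsrc : ∀ w ∈ W, φ w ∈ e.source := fun w hw => e.map_target hw
  have hstr : ∀ w ∈ W, i.insertNth (F (φ w)) (L (φ w)) = j w := by
    intro w hw
    have := e.right_inv hw
    rw [he, straighten_eq_insertNth] at this
    exact this
  have hFφ : ∀ w ∈ W, F (φ w) = r := fun w hw => by
    simpa [j] using congrFun (hstr w hw) i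
  have hLφ : ∀ w ∈ W, L (φ w) = w := fun w hw => by
    funext a
    simpa [j] using congrFun (hstr w hw) (i.succAbove a)
  have hsmooth : ∀ w ∈ W, ContDiffAt ℝ ∞ φ w := by
    intro w hw
    have hO' := heO (hsrc w hw)
    have := e.contDiffAt_symm hw (hasFDerivAt_straighten (hdat _ hO'.1) hO'.2)
      (contDiffAt_straighten (hFat _ hO'.1) i)
    exact this.comp w hj.contDiffAt
  refine ⟨e.source, W, φ, L, e.open_source, hpe, ⟨hW, fun w hw => (hsmooth w hw).contDiffWithinAt,
    fun w hw => linearIndependent_pd_of_leftInverse hW hw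
      ((hsmooth w hw).differentiableAt (by simp)) L hLφ,
    fun w hw => ⟨(heO (hsrc w hw)).1, hFφ w hw⟩⟩, ?_, L.continuous.continuousOn, hLφ⟩
  ext x
  constructor
  · rintro ⟨w, hw, rfl⟩
    exact ⟨⟨(heO (hsrc w hw)).1, hFφ w hw⟩, hsrc w hw⟩
  · rintro ⟨⟨_, hxr⟩, hxe⟩
    have hjx : j (L x) = e x := by
      rw [he, straighten_eq_insertNth, hxr]
      rfl
    refine ⟨L x, ?_, ?_⟩
    · change j (L x) ∈ e.target
      rw [hjx]
      exact e.map_source hxe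
    · change e.symm (j (L x)) = x
      rw [hjx, e.left_inv hxe]

end LevelSet

/-! ### The equiaffine normal of a level set -/

section Normal

open Matrix

variable {n : ℕ} {Ψ : (Fin (n + 1) → ℝ) [⋀^Fin (n + 1)]→ₗ[ℝ] ℝ} {F : (Fin (n + 1) → ℝ) → ℝ}
  {q : (Fin (n + 1) → ℝ) → ℝ} {s : Set (Fin (n + 1) → ℝ)} {W : Set (Fin n → ℝ)}
  {φ : (Fin n → ℝ) → (Fin (n + 1) → ℝ)} {w : Fin n → ℝ} {r : ℝ}
  {ξ : (Fin (n + 1) → ℝ) → (Fin (n + 1) → ℝ)}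

theorem mem_tangentSpan_iff (hs : IsOpen s) (hF : ContDiffOn ℝ ∞ F s) (hdF : ∀ x ∈ s, dF F x ≠ 0)
    (hφ : IsPatch {x | x ∈ s ∧ F x = r} W φ) (hw : w ∈ W) {y : Fin (n + 1) → ℝ} :
    y ∈ tangentSpan φ w ↔ dF F (φ w) ⬝ᵥ y = 0 :=
  span_range_eq_of_dotProduct_eq_zero (hφ.immersion w hw) (dF_dotProduct_pd_patch hs hF hφ hw)
    (hdF _ (hφ.mapsTo hw).1)

theorem sameCoorientation_iff (hs : IsOpen s) (hF : ContDiffOn ℝ ∞ F s)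
    (hU : ∀ x ∈ s, opU Ψ F x ≠ 0) (hφ : IsPatch {x | x ∈ s ∧ F x = r} W φ) (hw : w ∈ W) :
    (∃ c : ℝ, 0 < c ∧
      ξ (φ w) - c • -(Real.sign (opU Ψ F (φ w)) • fieldN Ψ F (φ w)) ∈ tangentSpan φ w)
      ↔ dF F (φ w) ⬝ᵥ ξ (φ w) < 0 := by
  have hU' := abs_pos.2 (hU _ (hφ.mapsTo hw).1)
  have habs : Real.sign (opU Ψ F (φ w)) * opU Ψ F (φ w) = |opU Ψ F (φ w)| := by
    rcases lt_or_gt_of_ne (hU _ (hφ.mapsTo hw).1) with h | h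
    · rw [Real.sign_of_neg h, abs_of_neg h]; ring
    · rw [Real.sign_of_pos h, abs_of_pos h]; ring
  have key : ∀ c : ℝ, ξ (φ w) - c • -(Real.sign (opU Ψ F (φ w)) • fieldN Ψ F (φ w))
      ∈ tangentSpan φ w ↔ dF F (φ w) ⬝ᵥ ξ (φ w) = -(c * |opU Ψ F (φ w)|) := by
    intro c
    rw [mem_tangentSpan_iff hs hF (fun x hx => dF_ne_zero (hU x hx)) hφ hw, dotProduct_sub,
      dotProduct_smul, dotProduct_neg, dotProduct_smul, dF_dotProduct_fieldN, smul_eq_mul,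
      smul_eq_mul, habs]
    constructor <;> intro h <;> linarith
  constructor
  · rintro ⟨c, hc, h⟩
    rw [(key c).1 h]
    have := mul_pos hc hU'
    linarith
  · intro h
    -- The constant is forced by `dF(-sign(U) N) = -|U|`.
    refine ⟨-(dF F (φ w) ⬝ᵥ ξ (φ w)) / |opU Ψ F (φ w)|, div_pos (by linarith) hU', ?_⟩
    rw [key, div_mul_cancel₀ _ hU'.ne', neg_neg]

/-- If `ξF = -|U|^{1/(n+2)}` along a level set, then `D ξ` is tangential exactly if
`F_{ij} ξ^j ≡ -|U|^{1/(n+2)} μ_i` on tangent vectors. -/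
theorem dF_dotProduct_pd_comp_eq (hs : IsOpen s) (hF : ContDiffOn ℝ ∞ F s)
    (hU : ∀ x ∈ s, opU Ψ F x ≠ 0) (hφ : IsPatch {x | x ∈ s ∧ F x = r} W φ)
    (hξd : DifferentiableAt ℝ (fun v => ξ (φ v)) w)
    (hξ : ∀ v ∈ W, dF F (φ v) ⬝ᵥ ξ (φ v) = -weight Ψ F (φ v)) (hw : w ∈ W) (a : Fin n) :
    dF F (φ w) ⬝ᵥ pd (fun v => ξ (φ v)) a w
      = -(weight Ψ F (φ w) * pd φ a w ⬝ᵥ mu Ψ F (φ w))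
        - pd φ a w ⬝ᵥ (hess F (φ w) *ᵥ ξ (φ w)) := by
  have hws := (hφ.mapsTo hw).1
  have h1 := pd_dF_dotProduct_comp hs hF (hφ.differentiableAt hw) hws hξd a
  have hwd : DifferentiableAt ℝ (fun x => -weight Ψ F x) (φ w) :=
    (((contDiffOn_weight hs hF hU).contDiffAt (hs.mem_nhds hws)).differentiableAt (by simp)).neg
  rw [pd_congr_of_eqOn hφ.isOpen hξ hw, pd_comp hwd (hφ.differentiableAt hw)] at h1
  have h2 : ∑ i, pd φ a w i • pd (fun x => -weight Ψ F x) i (φ w)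
      = -(weight Ψ F (φ w) * pd φ a w ⬝ᵥ mu Ψ F (φ w)) := by
    rw [dotProduct, Finset.mul_sum, ← Finset.sum_neg_distrib]
    refine Finset.sum_congr rfl fun i _ => ?_
    have : pd (fun x => -weight Ψ F x) i (φ w) = -pd (weight Ψ F) i (φ w) := by
      simp [pd, fderiv_fun_neg]
    rw [this, pd_weight hs hF hU hws, smul_eq_mul]
    ring
  rw [h2] at h1
  linarith

theorem eqOn_fieldNu (hΨ : Ψ ≠ 0) (hs : IsOpen s) (hF : ContDiffOn ℝ ∞ F s)
    (hU : ∀ x ∈ s, opU Ψ F x ≠ 0) (hq0 : ∀ x ∈ s, q x ≠ 0)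
    (hξ : IsEquiaffineNormal Ψ {x | x ∈ s ∧ F x = r} ξ)
    (hco : SameCoorientation {x | x ∈ s ∧ F x = r} ξ
      (fun x => -(Real.sign (opU Ψ F x) • fieldN Ψ F x))) :
    Set.EqOn ξ (fieldNu Ψ F q) {x | x ∈ s ∧ F x = r} := by
  intro p hp
  obtain ⟨O, W, φ, -, -, hpO, hφ, himg, -, -⟩ := hξ.hypersurface p hp
  obtain ⟨w, hw, rfl⟩ : p ∈ φ '' W := himg ▸ ⟨hp, hpO⟩
  obtain ⟨Γ, h, hG, hden, hpar, -⟩ := hξ.normalized W φ hφ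
  have hneg : ∀ v ∈ W, dF F (φ v) ⬝ᵥ ξ (φ v) < 0 := fun v hv =>
    (sameCoorientation_iff hs hF hU hφ hv).1 (hco W φ hφ v hv)
  have hweight : ∀ v ∈ W, dF F (φ v) ⬝ᵥ ξ (φ v) = -weight Ψ F (φ v) := by
    intro v hv
    rw [← density_eq_iff hΨ (hU _ (hφ.mapsTo hv).1) (hφ.immersion v hv)
      (dF_dotProduct_pd_patch hs hF hφ hv) (hneg v hv),
      ← secondFundamentalForm_eq hs hF hφ hv (hneg v hv).ne hG]
    exact hden v hv
  have hξd : DifferentiableAt ℝ (fun v => ξ (φ v)) w :=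
    ((hξ.transversal W φ hφ).1.contDiffAt (hφ.isOpen.mem_nhds hw)).differentiableAt (by simp)
  have hT := hφ.immersion w hw
  have hgT := dF_dotProduct_pd_patch hs hF hφ hw
  have hUp := hU _ (hφ.mapsTo hw).1
  have hqp := hq0 _ (hφ.mapsTo hw).1
  have hsym := isSymm_hess hs hF (hφ.mapsTo hw).1
  have hρ : inducedDensity Ψ φ ξ w ≠ 0 :=
    abs_ne_zero.2 (apply_cons_ne_zero hΨ hT hgT (hneg w hw).ne)
  have htan : ∀ a, dF F (φ w) ⬝ᵥ pd (fun v => ξ (φ v)) a w = 0 := by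
    intro a
    have h1 := (pd_inducedDensity hΨ hs hF hφ hw (hneg w hw).ne hξd hG).2 a
    have h2 := hpar.2 w hw a
    rw [h1, ← sub_mul, add_sub_cancel_left] at h2
    exact (div_eq_zero_iff.1 ((mul_eq_zero.1 h2).resolve_right hρ)).resolve_right (hneg w hw).ne
  have hmem : ξ (φ w) - fieldNu Ψ F q (φ w) ∈ tangentSpan φ w := by
    rw [mem_tangentSpan_iff hs hF (fun x hx => dF_ne_zero (hU x hx)) hφ hw, dotProduct_sub,
      hweight w hw, dF_dotProduct_fieldNu hΨ hsym hUp hqp, sub_self]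
  obtain ⟨t, ht⟩ := (Submodule.mem_span_range_iff_exists_fun ℝ).1 hmem
  -- `ξ` and `ν` pair equally with tangent vectors under the Hessian, so their tangent difference
  -- lies in the kernel of a nondegenerate form.
  have hzero : tangentHess F (φ w) (fun a => pd φ a w) *ᵥ t = 0 := by
    funext a
    have h1 : (tangentHess F (φ w) (fun a => pd φ a w) *ᵥ t) a
        = pd φ a w ⬝ᵥ (hess F (φ w) *ᵥ ∑ c, t c • pd φ c w) := by
      rw [mulVec_sum, dotProduct_sum]
      simp only [mulVec_smul, dotProduct_smul, smul_eq_mul, mul_comm (t _)]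
      rfl
    have h2 := dF_dotProduct_pd_comp_eq hs hF hU hφ hξd hweight hw a
    rw [htan] at h2
    rw [h1, ht, mulVec_sub, dotProduct_sub,
      tangent_dotProduct_hess_fieldNu hΨ hsym hUp hqp (hgT a), Pi.zero_apply]
    linarith
  have ht0 := eq_zero_of_mulVec_eq_zero (det_tangentHess_ne_zero hΨ hUp hT hgT) hzero
  rw [ht0] at ht
  simp only [Pi.zero_apply, zero_smul, Finset.sum_const_zero] at ht
  exact sub_eq_zero.1 ht.symm

theorem isEquiaffineNormal_of_eqOn_fieldNu (hΨ : Ψ ≠ 0) (hs : IsOpen s)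
    (hF : ContDiffOn ℝ ∞ F s) (hU : ∀ x ∈ s, opU Ψ F x ≠ 0) (hq : ContDiffOn ℝ ∞ q s)
    (hq0 : ∀ x ∈ s, q x ≠ 0) (hξ : Set.EqOn ξ (fieldNu Ψ F q) {x | x ∈ s ∧ F x = r}) :
    IsEquiaffineNormal Ψ {x | x ∈ s ∧ F x = r} ξ ∧
      SameCoorientation {x | x ∈ s ∧ F x = r} ξ
        (fun x => -(Real.sign (opU Ψ F x) • fieldN Ψ F x)) := by
  have hdF : ∀ x ∈ s, dF F x ≠ 0 := fun x hx => dF_ne_zero (hU x hx)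
  have hweight : ∀ x, x ∈ s ∧ F x = r → dF F x ⬝ᵥ ξ x = -weight Ψ F x := fun x hx => by
    rw [hξ hx, dF_dotProduct_fieldNu hΨ (isSymm_hess hs hF hx.1) (hU x hx.1) (hq0 x hx.1)]
  have hneg : ∀ x, x ∈ s ∧ F x = r → dF F x ⬝ᵥ ξ x < 0 := fun x hx => by
    rw [hweight x hx]
    exact neg_neg_of_pos (weight_pos (hU x hx.1))
  have hsmooth : ∀ (W : Set (Fin n → ℝ)) (φ : (Fin n → ℝ) → (Fin (n + 1) → ℝ)),
      IsPatch {x | x ∈ s ∧ F x = r} W φ → ContDiffOn ℝ ∞ (fun w => ξ (φ w)) W :=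
    fun W φ hφ => ((contDiffOn_fieldNu hΨ hs hF hU hq hq0).comp hφ.smooth
      fun w hw => (hφ.mapsTo hw).1).congr fun w hw => hξ (hφ.mapsTo hw)
  refine ⟨⟨isHypersurface_levelSet hs hF hdF r, fun W φ hφ => ⟨hsmooth W φ hφ, fun w hw => ?_⟩,
    fun W φ hφ => ?_⟩, fun W φ hφ w hw =>
      (sameCoorientation_iff hs hF hU hφ hw).2 (hneg _ (hφ.mapsTo hw))⟩
  · rw [mem_tangentSpan_iff hs hF hdF hφ hw]
    exact (hneg _ (hφ.mapsTo hw)).ne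
  obtain ⟨Γ, h, hG⟩ := exists_gaussFormula hs hF hφ fun w hw => (hneg _ (hφ.mapsTo hw)).ne
  have hden : ∀ w ∈ W, inducedDensity Ψ φ ξ w = metricDensity h w := by
    intro w hw
    have hp := hφ.mapsTo hw
    rw [metricDensity, secondFundamentalForm_eq hs hF hφ hw (hneg _ hp).ne hG]
    exact (density_eq_iff hΨ (hU _ hp.1) (hφ.immersion w hw)
      (dF_dotProduct_pd_patch hs hF hφ hw) (hneg _ hp)).2 (hweight _ hp)
  have hpar : IsParallelDensity W Γ (inducedDensity Ψ φ ξ) := by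
    have hξd : ∀ w ∈ W, DifferentiableAt ℝ (fun v => ξ (φ v)) w := fun w hw =>
      ((hsmooth W φ hφ).contDiffAt (hφ.isOpen.mem_nhds hw)).differentiableAt (by simp)
    have hpd := fun w hw =>
      pd_inducedDensity hΨ hs hF hφ hw (hneg _ (hφ.mapsTo hw)).ne (hξd w hw) hG
    refine ⟨fun w hw => (hpd w hw).1.differentiableWithinAt, fun w hw a => ?_⟩
    have hp := hφ.mapsTo hw
    have htan : dF F (φ w) ⬝ᵥ pd (fun v => ξ (φ v)) a w = 0 := by
      rw [dF_dotProduct_pd_comp_eq hs hF hU hφ (hξd w hw) (fun v hv => hweight _ (hφ.mapsTo hv)) hw,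
        hξ hp, tangent_dotProduct_hess_fieldNu hΨ (isSymm_hess hs hF hp.1) (hU _ hp.1)
          (hq0 _ hp.1) (dF_dotProduct_pd_patch hs hF hφ hw a), sub_self]
    rw [(hpd w hw).2 a, htan, zero_div, add_zero, sub_self]
  -- The metric density is parallel because it coincides with the induced one on the open set `W`.
  refine ⟨Γ, h, hG, hden, hpar, hpar.1.congr fun w hw => (hden w hw).symm, fun w hw a => ?_⟩
  rw [← pd_congr_of_eqOn hφ.isOpen hden hw, ← hden w hw]
  exact hpar.2 w hw a

end Normal

end Equiaffine

end

/-! ### The theorem on a connected component -/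

theorem theorem2p15 {n : ℕ} (hn : 1 ≤ n)
    (Ψ : (Fin (n + 1) → ℝ) [⋀^Fin (n + 1)]→ₗ[ℝ] ℝ) (hΨ : Ψ ≠ 0)
    (V : Set (Fin (n + 1) → ℝ)) (hV : IsOpen V)
    (F : (Fin (n + 1) → ℝ) → ℝ) (hF : ContDiffOn ℝ ∞ F V)
    (x₀ : Fin (n + 1) → ℝ) (hx₀ : x₀ ∈ {x | x ∈ V ∧ Equiaffine.opU Ψ F x ≠ 0})
    (Ω : Set (Fin (n + 1) → ℝ))
    (hΩ : Ω = connectedComponentIn {x | x ∈ V ∧ Equiaffine.opU Ψ F x ≠ 0} x₀)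
    (q : (Fin (n + 1) → ℝ) → ℝ) (hq : ContDiffOn ℝ ∞ q Ω) (hq0 : ∀ x ∈ Ω, q x ≠ 0)
    (r : ℝ) (hr : {x | x ∈ Ω ∧ F x = r}.Nonempty)
    (ξ : (Fin (n + 1) → ℝ) → (Fin (n + 1) → ℝ)) :
    (Equiaffine.IsEquiaffineNormal Ψ {x | x ∈ Ω ∧ F x = r} ξ ∧
      Equiaffine.SameCoorientation {x | x ∈ Ω ∧ F x = r} ξ
        (fun x => -(Real.sign (Equiaffine.opU Ψ F x) • Equiaffine.fieldN Ψ F x))) ↔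
    Set.EqOn ξ (Equiaffine.fieldNu Ψ F q) {x | x ∈ Ω ∧ F x = r} := by
  have hUpre : IsOpen {x | x ∈ V ∧ Equiaffine.opU Ψ F x ≠ 0} :=
    (Equiaffine.contDiffOn_opU hV hF).continuousOn.isOpen_inter_preimage hV isOpen_ne
  -- Components of open sets are open because `ℝⁿ⁺¹` is locally connected, so the preceding results
  -- apply with `s = Ω`.
  have hΩo : IsOpen Ω := hΩ ▸ hUpre.connectedComponentIn
  have hsub : Ω ⊆ {x | x ∈ V ∧ Equiaffine.opU Ψ F x ≠ 0} := hΩ ▸ connectedComponentIn_subset _ _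
  have hFΩ : ContDiffOn ℝ ∞ F Ω := hF.mono fun x hx => (hsub hx).1
  have hU : ∀ x ∈ Ω, Equiaffine.opU Ψ F x ≠ 0 := fun x hx => (hsub hx).2
  exact ⟨fun h => Equiaffine.eqOn_fieldNu hΨ hΩo hFΩ hU hq0 h.1 h.2,
    Equiaffine.isEquiaffineNormal_of_eqOn_fieldNu hΨ hΩo hFΩ hU hq hq0⟩
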